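/- **Theorem 2.** Let $d\ge 1$, let $m_{\mathrm B}\in\mathbb R^d$, let $\Sigma_{\mathrm B}\in\mathbb R^{d\times d}$ be symmetric positive definite, and let $\mu_{\mathrm B}=\mathcal N(m_{\mathrm B},\Sigma_{\mathrm B})$, with density $\rho_{\mathrm B}=\frac{\mathrm d\mu_{\mathrm B}}{\mathrm dx}$. Let $\rho_*$ be a probability density on $\mathbb R^d$ with $\rho_*\log\rho_*\in L^1(\mathbb R^d)$, such that $\rho_*>0$ almost everywhere and $\log\rho_*\in L^1_{\mathrm{loc}}(\mathbb R^d)$ (for example, $\rho_*$ is bounded below by a positive constant on every ball), and such that for some $M>0$ and $\sigma_\bullet>0$ $$\rho_*(x)\ \ge\ \frac{1}{(2\pi\sigma_\bullet^2)^{d/2}}\,e^{-\|x\|^2/(2\sigma_\bullet^2)}\qquad\text{for all }\|x\|\ge M .$$ Put $\mu_*=\rho_*\,\mathrm dx$. Then for every $T>0$ and every $\varepsilon>0$ there is a control $\theta=(w,a,b):[0,T]\to\mathbb R^d\times\mathbb R^d\times\mathbb R$, piecewise constant with finitely many switches, such that the following holds. Let $v(x,\theta)=w\,(a^\top x+b)_+$,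 where $(s)_+=\max\{s,0\}$, let $\Phi_\theta^T:\mathbb R^d\to\mathbb R^d$ be the time-$T$ flow map of $\dot x(t)=v(x(t),\theta(t))$, and let $\rho\in C^0([0,T];L^1(\mathbb R^d))\cap L^\infty([0,T]\times\mathbb R^d)$ be the weak solution of $$\partial_t\rho(t,x)+\operatorname{div}\big(v(x,\theta(t))\,\rho(t,x)\big)=0\ \text{ in }[0,T]\times\mathbb R^d,\qquad \rho(0,\cdot)=\rho_{\mathrm B}.$$ Then $\rho(T,\cdot)$ is the density of $\Phi^T_{\theta\#}\mu_{\mathrm B}$, and $$\int_{\mathbb R^d}\rho(T,x)\log\frac{\rho(T,x)}{\rho_*(x)}\,\mathrm dx\le\varepsilon ,\qquad\text{equivalently}\qquad \mathsf{KL}\big(\Phi^T_{\theta\#}\mu_{\mathrm B}\,\big\|\,\mu_*\big)\le\varepsilon .$$ -/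

import Mathlib

open MeasureTheory Filter Topology
open scoped ContDiff

namespace NeuralTransport

/-- Parameters `(w, a, b)` of one neuron: `θ.1 = w`, `θ.2.1 = a`, `θ.2.2 = b`. -/
abbrev Param (d : ℕ) : Type :=
  EuclideanSpace ℝ (Fin d) × EuclideanSpace ℝ (Fin d) × ℝ

/-- The perceptron velocity field `v(x, (w, a, b)) = (a · x + b)₊ w`. -/
noncomputable def velocity {d : ℕ} (x : EuclideanSpace ℝ (Fin d)) (θ : Param d) :
    EuclideanSpace ℝ (Fin d) :=
  max (inner ℝ θ.2.1 x + θ.2.2) 0 • θ.1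

/-- `θ` is piecewise constant on `[0, T]` with finitely many switches: there are
`0 = t₀ < t₁ < ⋯ < t_K = T` such that `θ` is constant on each `[t_{k-1}, t_k)`. -/
def IsPiecewiseConstant {d : ℕ} (T : ℝ) (θ : ℝ → Param d) : Prop :=
  ∃ (K : ℕ) (t : Fin (K + 1) → ℝ) (c : Fin K → Param d),
    StrictMono t ∧ t 0 = 0 ∧ t (Fin.last K) = T ∧
      ∀ k : Fin K, ∀ s ∈ Set.Ico (t k.castSucc) (t k.succ), θ s = c k

/-- `Φ` is the flow on `[0, T]` of `x'(t) = v(x(t), θ(t))`, `x(0) = x`, the equation being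
understood in integrated form since `θ` is allowed to jump. -/
def IsFlow {d : ℕ} (T : ℝ) (θ : ℝ → Param d)
    (Φ : ℝ → EuclideanSpace ℝ (Fin d) → EuclideanSpace ℝ (Fin d)) : Prop :=
  ∀ x, ContinuousOn (fun t => Φ t x) (Set.Icc 0 T) ∧
    ∀ t ∈ Set.Icc 0 T, Φ t x = x + ∫ s in (0 : ℝ)..t, velocity (Φ s x) (θ s)

/-- `ρ` is a weak solution on `[0, T]` of `∂ₜρ + div(v(x, θ(t)) ρ) = 0`, `ρ(0) = ρ₀`, which is
continuous in time with values in `L¹` and bounded in `L^∞`. -/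
structure IsContinuitySolution {d : ℕ} (T : ℝ) (θ : ℝ → Param d)
    (ρ₀ : EuclideanSpace ℝ (Fin d) → ℝ) (ρ : ℝ → EuclideanSpace ℝ (Fin d) → ℝ) : Prop where
  integrable : ∀ t ∈ Set.Icc 0 T, Integrable (ρ t)
  bounded : ∃ C : ℝ, ∀ t ∈ Set.Icc 0 T, ∀ᵐ x, |ρ t x| ≤ C
  continuous : ∀ t ∈ Set.Icc 0 T,
    Tendsto (fun s => ∫ x, |ρ s x - ρ t x|) (𝓝[Set.Icc 0 T] t) (𝓝 0)
  initial : ρ 0 =ᵐ[volume] ρ₀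
  weak : ∀ φ : EuclideanSpace ℝ (Fin d) → ℝ, ContDiff ℝ ∞ φ → HasCompactSupport φ →
    ∀ t ∈ Set.Icc 0 T,
      ∫ x, φ x * ρ t x = (∫ x, φ x * ρ₀ x) +
        ∫ s in (0 : ℝ)..t, ∫ x, fderiv ℝ φ x (velocity x (θ s)) * ρ s x

/-- Probability densities with respect to Lebesgue measure. -/
structure IsProbDensity {d : ℕ} (ρ : EuclideanSpace ℝ (Fin d) → ℝ) : Prop where
  nonneg : ∀ x, 0 ≤ ρ x
  integrable : Integrable ρ
  integral_eq_one : ∫ x, ρ x = 1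

/-- The measure `ρ dx`. -/
noncomputable def densityMeasure {d : ℕ} (ρ : EuclideanSpace ℝ (Fin d) → ℝ) :
    Measure (EuclideanSpace ℝ (Fin d)) :=
  volume.withDensity fun x => ENNReal.ofReal (ρ x)

/-- The density of the centered Gaussian with covariance `σ² I`. -/
noncomputable def isoGaussianDensity {d : ℕ} (σ : ℝ) (x : EuclideanSpace ℝ (Fin d)) : ℝ :=
  1 / (2 * Real.pi * σ ^ 2) ^ ((d : ℝ) / 2) * Real.exp (-‖x‖ ^ 2 / (2 * σ ^ 2))

end NeuralTransport

open NeuralTransport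

/-!
Let `klInf r p` be the infimum of `KL(F_# (p dx) ‖ r dx)` over the group of homeomorphisms `F`
generated by the flow maps of single neurons. Since a neuron may be run backwards and its speed
rescaled, every member of the group is reached in any prescribed time, so it suffices that
`klInf r g = 0` for the initial density `g`. The functional `klInf r` is invariant under the group
and, as an infimum of functionals continuous along suitably dominated limits, upper semicontinuous
along them: if densities `p n` converge to `q`, then a lower bound for all `klInf r (p n)` is one
for `klInf r q`.

Shears by sums of ReLUs, conjugated with a single expansion, stretch space above a graph. When the
slopes of the graph outside a cell tend to infinity, they stretch in the limit only the part of the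
density above that cell. This moves the interface between two halves of a box, so that a density
constant on each half becomes constant on the whole box. By repeated bisection and step
approximation, a continuous positive density may be replaced on a box by any other one of equal mass
there without changing `klInf r`. Exhausting the space by boxes gives `klInf r g ≤ klInf r q` for
every `q` of equal mass with Gaussian decay. For `q` proportional to `min r (n e^{-|x|²})` the
entropy `KL(q dx ‖ r dx)` is at most the logarithm of the normalising constant, which tends to `0`
as `n → ∞`.
-/

namespace NeuralTransport

open InformationTheory
open ProbabilityTheory (stdGaussian multivariateGaussian charFun_stdGaussian)

variable {d : ℕ}

local notation "𝔼" => EuclideanSpace ℝ (Fin d)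

/-! ### Transport of densities by homeomorphisms -/

section Jacobian

variable {X : Type*} [TopologicalSpace X] [MeasurableSpace X] {μ : Measure X}
  {F G : X ≃ₜ X} {J K p : X → ℝ}

/-- `p · μ` is carried by `F` to `pushDensity F J p · μ` when `J` is the Jacobian density of `F`
in the sense of `HasJacobian`. -/
def pushDensity (F : X ≃ₜ X) (J p : X → ℝ) (y : X) : ℝ := p (F.symm y) * J y

/-- `J` is a bounded density of the image of `μ` under `F`; for Lebesgue measure this is the
Jacobian determinant of the inverse of `F`, in absolute value. -/
structure HasJacobian (μ : Measure X) (F : X ≃ₜ X) (J : X → ℝ) : Prop where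
  measurable : Measurable J
  nonneg : ∀ y, 0 ≤ J y
  bounded : ∃ C, ∀ y, J y ≤ C
  map_eq : μ.map F = μ.withDensity fun y => ENNReal.ofReal (J y)

/-- Nonnegative measurable integrable functions, the densities of finite measures. The total mass
is not normalized. -/
structure IsDensity (μ : Measure X) (p : X → ℝ) : Prop where
  measurable : Measurable p
  nonneg : ∀ x, 0 ≤ p x
  integrable : Integrable p μ

/-- Bounded densities: the initial data for which the continuity equation is solved. -/
structure IsBoundedDensity (μ : Measure X) (p : X → ℝ) : Prop extends IsDensity μ p where
  bounded : ∃ C, ∀ x, p x ≤ C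

lemma HasJacobian.of_measurePreserving (hF : MeasurePreserving F μ μ) :
    HasJacobian μ F fun _ => 1 where
  measurable := measurable_const
  nonneg _ := zero_le_one
  bounded := ⟨1, fun _ => le_rfl⟩
  map_eq := by simp [hF.map_eq]

variable [BorelSpace X]

namespace HasJacobian

lemma integral_pushDensity (hF : HasJacobian μ F J) (f : X → ℝ) :
    ∫ y, pushDensity F J f y ∂μ = ∫ x, f x ∂μ := by
  have hmap := F.measurableEmbedding.integral_map (μ := μ) fun y => f (F.symm y)
  simp only [Homeomorph.symm_apply_apply] at hmap
  rw [← hmap, hF.map_eq, integral_withDensity_eq_integral_toReal_smul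
    hF.measurable.ennreal_ofReal (ae_of_all _ fun _ => ENNReal.ofReal_lt_top)]
  refine integral_congr_ae (ae_of_all _ fun y => ?_)
  simp [pushDensity, ENNReal.toReal_ofReal (hF.nonneg y), mul_comm]

lemma integrable_pushDensity (hF : HasJacobian μ F J) {f : X → ℝ} (hf : Integrable f μ) :
    Integrable (pushDensity F J f) μ := by
  have hmap : Integrable (fun y => f (F.symm y)) (μ.map F) :=
    F.measurableEmbedding.integrable_map_iff.2 (hf.congr (ae_of_all _ fun x => by simp))
  rw [hF.map_eq, integrable_withDensity_iff_integrable_smul' hF.measurable.ennreal_ofReal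
    (ae_of_all _ fun _ => ENNReal.ofReal_lt_top)] at hmap
  refine hmap.congr (ae_of_all _ fun y => ?_)
  simp [pushDensity, ENNReal.toReal_ofReal (hF.nonneg y), mul_comm]

lemma map_withDensity (hF : HasJacobian μ F J) (hp : Measurable p) :
    (μ.withDensity fun x => ENNReal.ofReal (p x)).map F =
      μ.withDensity fun y => ENNReal.ofReal (pushDensity F J p y) := by
  have hpF : Measurable fun y => ENNReal.ofReal (p (F.symm y)) :=
    (hp.comp F.symm.measurable).ennreal_ofReal
  ext s hs
  rw [Measure.map_apply F.measurable hs, withDensity_apply _ (F.measurable hs),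
    withDensity_apply _ hs]
  calc ∫⁻ x in F ⁻¹' s, ENNReal.ofReal (p x) ∂μ
      = ∫⁻ y in s, ENNReal.ofReal (p (F.symm y)) ∂(μ.map F) := by
        simp [setLIntegral_map hs hpF F.measurable]
    _ = ∫⁻ y in s, ENNReal.ofReal (pushDensity F J p y) ∂μ := by
        rw [hF.map_eq, setLIntegral_withDensity_eq_setLIntegral_mul _
          hF.measurable.ennreal_ofReal hpF hs]
        refine lintegral_congr fun y => ?_
        rw [Pi.mul_apply, pushDensity, mul_comm (p _), ENNReal.ofReal_mul (hF.nonneg y)]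

lemma trans (hF : HasJacobian μ F J) (hG : HasJacobian μ G K) :
    HasJacobian μ (F.trans G) (pushDensity G K J) where
  measurable := (hF.measurable.comp G.symm.measurable).mul hG.measurable
  nonneg y := mul_nonneg (hF.nonneg _) (hG.nonneg _)
  bounded := by
    obtain ⟨C, hC⟩ := hF.bounded
    obtain ⟨C', hC'⟩ := hG.bounded
    exact ⟨C * C', fun y => mul_le_mul (hC _) (hC' _) (hG.nonneg _) ((hF.nonneg y).trans (hC y))⟩
  map_eq := by
    rw [← hG.map_withDensity hF.measurable, ← hF.map_eq,
      Measure.map_map G.measurable F.measurable]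
    rfl

end HasJacobian

lemma IsDensity.push (hp : IsDensity μ p) (hF : HasJacobian μ F J) :
    IsDensity μ (pushDensity F J p) where
  measurable := (hp.measurable.comp F.symm.measurable).mul hF.measurable
  nonneg _ := mul_nonneg (hp.nonneg _) (hF.nonneg _)
  integrable := hF.integrable_pushDensity hp.integrable

lemma IsBoundedDensity.push (hp : IsBoundedDensity μ p) (hF : HasJacobian μ F J) :
    IsBoundedDensity μ (pushDensity F J p) where
  toIsDensity := hp.toIsDensity.push hF
  bounded := by
    obtain ⟨C, hC⟩ := hp.bounded
    obtain ⟨C', hC'⟩ := hF.bounded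
    exact ⟨C * C', fun y => mul_le_mul (hC _) (hC' _) (hF.nonneg _)
      ((hp.nonneg (F.symm y)).trans (hC _))⟩

end Jacobian

/-! ### The flow of a single neuron -/

/-- The integral `∫₀ᵗ e^{l s} ds`, that is `(e^{l t} - 1) / l`, or `t` when `l = 0`. It is the
coefficient by which the flow of a neuron displaces a point. -/
noncomputable def expInt (l t : ℝ) : ℝ := ∫ s in (0 : ℝ)..t, Real.exp (l * s)

lemma hasDerivAt_expInt (l t : ℝ) : HasDerivAt (expInt l) (Real.exp (l * t)) t := by
  have hc : Continuous fun s : ℝ => Real.exp (l * s) := by fun_prop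
  exact intervalIntegral.integral_hasDerivAt_right (hc.intervalIntegrable _ _)
    hc.stronglyMeasurable.stronglyMeasurableAtFilter hc.continuousAt

@[simp] lemma expInt_zero (l : ℝ) : expInt l 0 = 0 := by simp [expInt]

@[simp] lemma expInt_zero_left (t : ℝ) : expInt 0 t = t := by simp [expInt]

lemma continuous_expInt (l : ℝ) : Continuous (expInt l) :=
  continuous_iff_continuousAt.2 fun t => (hasDerivAt_expInt l t).continuousAt

lemma mul_expInt (l t : ℝ) : l * expInt l t = Real.exp (l * t) - 1 := by
  simp [expInt]

lemma expInt_add (l s t : ℝ) :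
    expInt l (s + t) = expInt l s + Real.exp (l * s) * expInt l t := by
  rcases eq_or_ne l 0 with rfl | hl
  · simp
  refine mul_left_cancel₀ hl ?_
  have hexp : Real.exp (l * (s + t)) = Real.exp (l * s) * Real.exp (l * t) := by
    rw [mul_add, Real.exp_add]
  linear_combination mul_expInt l (s + t) - mul_expInt l s - Real.exp (l * s) * mul_expInt l t
    + hexp

lemma mul_expInt_mul_left (c l t : ℝ) : c * expInt (c * l) t = expInt l (c * t) := by
  rcases eq_or_ne l 0 with rfl | hl
  · simp
  refine mul_left_cancel₀ hl ?_
  have hexp : Real.exp (c * l * t) = Real.exp (l * (c * t)) := by ring_nf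
  linear_combination mul_expInt (c * l) t - mul_expInt l (c * t) + hexp

/-- The growth rate `a · w` of the pre-activation along the flow of the neuron `(w, a, b)`. -/
noncomputable def rate (θ : Param d) : ℝ := inner ℝ θ.2.1 θ.1

/-- The pre-activation `a · x + b` of the neuron `(w, a, b)`. -/
noncomputable def preact (θ : Param d) (x : 𝔼) : ℝ := inner ℝ θ.2.1 x + θ.2.2

/-- The flow of the affine field `x ↦ (a · x + b) w`, which is `velocity` with the rectifier
removed. -/
noncomputable def affineFlow (θ : Param d) (t : ℝ) (x : 𝔼) : 𝔼 :=
  x + (expInt (rate θ) t * preact θ x) • θ.1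

/-- The flow of `velocity`: the affine flow where the neuron is active and the identity
elsewhere. -/
noncomputable def flowMap (θ : Param d) (t : ℝ) (x : 𝔼) : 𝔼 :=
  x + (expInt (rate θ) t * max (preact θ x) 0) • θ.1

@[fun_prop] lemma continuous_preact (θ : Param d) : Continuous (preact θ) := by
  unfold preact; fun_prop

lemma measurableSet_nonneg_preact (θ : Param d) : MeasurableSet {y | 0 ≤ preact θ y} :=
  measurableSet_le measurable_const (continuous_preact θ).measurable

lemma velocity_eq (θ : Param d) (x : 𝔼) : velocity x θ = max (preact θ x) 0 • θ.1 := rfl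

lemma continuous_velocity (θ : Param d) : Continuous fun x => velocity x θ := by
  simp only [velocity_eq]; fun_prop

lemma continuous_flowMap_uncurry (θ : Param d) :
    Continuous fun z : ℝ × 𝔼 => flowMap θ z.1 z.2 := by
  have := continuous_expInt (rate θ)
  unfold flowMap; fun_prop

lemma continuous_flowMap_time (θ : Param d) (x : 𝔼) : Continuous fun t => flowMap θ t x :=
  (continuous_flowMap_uncurry θ).comp (by fun_prop : Continuous fun t : ℝ => (t, x))

lemma preact_affineFlow (θ : Param d) (t : ℝ) (x : 𝔼) :
    preact θ (affineFlow θ t x) = Real.exp (rate θ * t) * preact θ x := by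
  have hexp := mul_expInt (rate θ) t
  simp only [rate, preact, affineFlow, inner_add_right, real_inner_smul_right] at hexp ⊢
  linear_combination (inner ℝ θ.2.1 x + θ.2.2) * hexp

lemma nonneg_preact_affineFlow_iff (θ : Param d) (t : ℝ) (x : 𝔼) :
    0 ≤ preact θ (affineFlow θ t x) ↔ 0 ≤ preact θ x := by
  rw [preact_affineFlow, mul_nonneg_iff_of_pos_left (Real.exp_pos _)]

lemma flowMap_of_nonneg (θ : Param d) (t : ℝ) {x : 𝔼} (h : 0 ≤ preact θ x) :
    flowMap θ t x = affineFlow θ t x := by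
  rw [flowMap, max_eq_left h, affineFlow]

lemma flowMap_of_nonpos (θ : Param d) (t : ℝ) {x : 𝔼} (h : preact θ x ≤ 0) :
    flowMap θ t x = x := by
  simp [flowMap, max_eq_right h]

@[simp] lemma flowMap_zero (θ : Param d) (x : 𝔼) : flowMap θ 0 x = x := by
  simp [flowMap]

lemma max_preact_flowMap (θ : Param d) (t : ℝ) (x : 𝔼) :
    max (preact θ (flowMap θ t x)) 0 = Real.exp (rate θ * t) * max (preact θ x) 0 := by
  rcases le_total 0 (preact θ x) with h | h
  · rw [flowMap_of_nonneg θ t h, preact_affineFlow, max_eq_left h, max_eq_left (by positivity)]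
  · rw [flowMap_of_nonpos θ t h, max_eq_right h, mul_zero]

lemma nonneg_preact_flowMap_iff (θ : Param d) (t : ℝ) (x : 𝔼) :
    0 ≤ preact θ (flowMap θ t x) ↔ 0 ≤ preact θ x := by
  rcases le_total 0 (preact θ x) with h | h
  · rw [flowMap_of_nonneg θ t h, nonneg_preact_affineFlow_iff]
  · rw [flowMap_of_nonpos θ t h]

lemma flowMap_flowMap (θ : Param d) (s t : ℝ) (x : 𝔼) :
    flowMap θ s (flowMap θ t x) = flowMap θ (t + s) x := by
  conv_lhs => rw [flowMap, max_preact_flowMap, flowMap]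
  rw [flowMap, expInt_add, add_assoc, ← add_smul]
  congr 2; ring

lemma hasDerivAt_flowMap (θ : Param d) (t : ℝ) (x : 𝔼) :
    HasDerivAt (fun s => flowMap θ s x) (velocity (flowMap θ t x) θ) t := by
  rw [velocity_eq, max_preact_flowMap]
  exact (((hasDerivAt_expInt (rate θ) t).mul_const _).smul_const θ.1).const_add x

lemma flowMap_smul (θ : Param d) (c t : ℝ) :
    flowMap ((c • θ.1, θ.2) : Param d) t = flowMap θ (c * t) := by
  have hrate : rate ((c • θ.1, θ.2) : Param d) = c * rate θ := by
    simp [rate, real_inner_smul_right]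
  ext1 x
  change x + (expInt (rate _) t * max (preact θ x) 0) • (c • θ.1) = _
  rw [hrate, smul_smul, flowMap, ← mul_expInt_mul_left]
  congr 2; ring

/-- The time-`t` flow map of a neuron as a homeomorphism; its inverse runs the flow backwards. -/
noncomputable def flowHomeo (θ : Param d) (t : ℝ) : 𝔼 ≃ₜ 𝔼 where
  toFun := flowMap θ t
  invFun := flowMap θ (-t)
  left_inv x := by simp [flowMap_flowMap]
  right_inv x := by simp [flowMap_flowMap]
  continuous_toFun := (continuous_flowMap_uncurry θ).comp (by fun_prop : Continuous fun x => (t, x))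
  continuous_invFun :=
    (continuous_flowMap_uncurry θ).comp (by fun_prop : Continuous fun x => (-t, x))

@[simp] lemma flowHomeo_apply (θ : Param d) (t : ℝ) (x : 𝔼) :
    flowHomeo θ t x = flowMap θ t x := rfl

@[simp] lemma flowHomeo_symm_apply (θ : Param d) (t : ℝ) (x : 𝔼) :
    (flowHomeo θ t).symm x = flowMap θ (-t) x := rfl

lemma volume_preimage_affineFlow (θ : Param d) (t : ℝ) (s : Set 𝔼) :
    volume (affineFlow θ t ⁻¹' s) = ENNReal.ofReal (Real.exp (-(rate θ * t))) * volume s := by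
  set L := LinearMap.transvection (innerSL ℝ θ.2.1).toLinearMap (expInt (rate θ) t • θ.1) with hL
  have hdet : LinearMap.det L = Real.exp (rate θ * t) := by
    rw [hL, LinearMap.transvection.det, ContinuousLinearMap.coe_coe, innerSL_apply_apply,
      real_inner_smul_right, ← rate, mul_comm, mul_expInt, add_sub_cancel]
  have haff : affineFlow θ t = fun x => L x + (expInt (rate θ) t * θ.2.2) • θ.1 := by
    ext1 x
    rw [affineFlow, hL, LinearMap.transvection.apply, ContinuousLinearMap.coe_coe,
      innerSL_apply_apply, preact]
    module
  have hpre : affineFlow θ t ⁻¹' s =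
      L ⁻¹' ((fun y => y + (expInt (rate θ) t * θ.2.2) • θ.1) ⁻¹' s) := by
    rw [haff]; rfl
  rw [hpre, Measure.addHaar_preimage_linearMap _ (by rw [hdet]; positivity), hdet,
    measure_preimage_add_right, abs_of_pos (by positivity), Real.exp_neg]

lemma volume_preimage_flowMap_of_subset (θ : Param d) (t : ℝ) {s : Set 𝔼}
    (hs : s ⊆ {y | 0 ≤ preact θ y}) :
    volume (flowMap θ t ⁻¹' s) = ENNReal.ofReal (Real.exp (-(rate θ * t))) * volume s := by
  have hpre : flowMap θ t ⁻¹' s = affineFlow θ t ⁻¹' s := by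
    ext x
    refine ⟨fun hx => ?_, fun hx => ?_⟩
    · rwa [Set.mem_preimage, ← flowMap_of_nonneg θ t ((nonneg_preact_flowMap_iff θ t x).1 (hs hx))]
    · rwa [Set.mem_preimage, flowMap_of_nonneg θ t ((nonneg_preact_affineFlow_iff θ t x).1 (hs hx))]
  rw [hpre, volume_preimage_affineFlow]

lemma preimage_flowMap_sdiff (θ : Param d) (t : ℝ) (s : Set 𝔼) :
    flowMap θ t ⁻¹' (s \ {y | 0 ≤ preact θ y}) = s \ {y | 0 ≤ preact θ y} := by
  ext x
  by_cases hx : 0 ≤ preact θ x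
  · simp [nonneg_preact_flowMap_iff, hx]
  · simp [flowMap_of_nonpos θ t (not_le.1 hx).le]

/-- The density of the image of Lebesgue measure under the time-`t` flow map of a neuron. -/
noncomputable def flowJac (θ : Param d) (t : ℝ) (y : 𝔼) : ℝ :=
  if 0 ≤ preact θ y then Real.exp (-(rate θ * t)) else 1

lemma measurable_flowJac (θ : Param d) (t : ℝ) : Measurable (flowJac θ t) :=
  Measurable.ite (measurableSet_nonneg_preact θ) measurable_const measurable_const

lemma flowJac_pos (θ : Param d) (t : ℝ) (y : 𝔼) : 0 < flowJac θ t y := by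
  unfold flowJac; split_ifs <;> positivity

lemma flowJac_le (θ : Param d) (t : ℝ) (y : 𝔼) : flowJac θ t y ≤ Real.exp (|rate θ| * |t|) := by
  unfold flowJac
  split_ifs
  · rw [← abs_mul]
    exact Real.exp_le_exp.2 (neg_le_abs _)
  · exact Real.one_le_exp (by positivity)

lemma hasJacobian_flowHomeo (θ : Param d) (t : ℝ) :
    HasJacobian volume (flowHomeo θ t) (flowJac θ t) where
  measurable := measurable_flowJac θ t
  nonneg y := (flowJac_pos θ t y).le
  bounded := ⟨_, flowJac_le θ t⟩
  map_eq := by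
    have hFm : Measurable (flowHomeo θ t) := (flowHomeo θ t).measurable
    have hP := measurableSet_nonneg_preact θ
    ext s hs
    rw [Measure.map_apply hFm hs, withDensity_apply _ hs, ← measure_inter_add_sdiff _ (hFm hP),
      ← lintegral_inter_add_sdiff _ s hP, ← Set.preimage_inter, ← Set.preimage_sdiff]
    congr 1
    · refine (volume_preimage_flowMap_of_subset θ t Set.inter_subset_right).trans ?_
      rw [setLIntegral_congr_fun (hs.inter hP)
        (g := fun _ => ENNReal.ofReal (Real.exp (-(rate θ * t)))) fun y hy => by
          rw [flowJac, if_pos (show 0 ≤ preact θ y from hy.2)], setLIntegral_const]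
    · refine (congrArg volume (preimage_flowMap_sdiff θ t s)).trans ?_
      rw [setLIntegral_congr_fun (hs.diff hP) (g := fun _ => 1) fun y hy => by
        rw [flowJac, if_neg (show ¬ 0 ≤ preact θ y from hy.2), ENNReal.ofReal_one],
        setLIntegral_const, one_mul]

/-! ### Concatenating controls -/

section Concatenation

variable {α V : Type*} [NormedAddCommGroup V] [NormedSpace ℝ V] {T T' : ℝ}

/-- Follow `f` on `[0, T)` and then `g`, started at time `T`. -/
noncomputable def concat (T : ℝ) (f g : ℝ → α) (s : ℝ) : α :=
  if s < T then f s else g (s - T)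

lemma concat_of_lt {s : ℝ} (f g : ℝ → α) (h : s < T) : concat T f g s = f s := if_pos h

lemma concat_of_ge {s : ℝ} (f g : ℝ → α) (h : T ≤ s) : concat T f g s = g (s - T) :=
  if_neg h.not_gt

lemma concat_of_le {s : ℝ} {f g : ℝ → α} (hfg : g 0 = f T) (h : s ≤ T) :
    concat T f g s = f s := by
  rcases h.lt_or_eq with h | rfl
  · exact concat_of_lt f g h
  · rw [concat_of_ge f g le_rfl, sub_self, hfg]

lemma concat_add (f g : ℝ → α) (hT' : 0 ≤ T') : concat T f g (T + T') = g T' := by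
  rw [concat_of_ge f g (le_add_of_nonneg_right hT'), add_sub_cancel_left]

lemma forall_concat {P : α → Prop} {f g : ℝ → α} (hf : ∀ t ∈ Set.Icc 0 T, P (f t))
    (hg : ∀ t ∈ Set.Icc 0 T', P (g t)) : ∀ t ∈ Set.Icc 0 (T + T'), P (concat T f g t) := by
  intro t ht
  rcases lt_or_ge t T with htT | htT
  · rw [concat_of_lt f g htT]
    exact hf t ⟨ht.1, htT.le⟩
  · rw [concat_of_ge f g htT]
    exact hg _ ⟨by linarith, by linarith [ht.2]⟩

lemma tendsto_concat (D : α → α → ℝ) {l : Filter ℝ} {f g : ℝ → α} (hfg : g 0 = f T)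
    (hf : ∀ t ∈ Set.Icc 0 T, Tendsto (fun s => D (f s) (f t)) (𝓝[Set.Icc 0 T] t) l)
    (hg : ∀ t ∈ Set.Icc 0 T', Tendsto (fun s => D (g s) (g t)) (𝓝[Set.Icc 0 T'] t) l) (t : ℝ) :
    Tendsto (fun s => D (concat T f g s) (concat T f g t)) (𝓝[Set.Icc 0 (T + T')] t) l := by
  have hcover : Set.Icc 0 (T + T') ⊆ Set.Icc 0 T ∪ Set.Icc T (T + T') :=
    Set.Icc_subset_Icc_union_Icc
  refine Tendsto.mono_left ?_ (nhdsWithin_mono t hcover)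
  have hbot : ∀ {a b : ℝ}, t ∉ Set.Icc a b → 𝓝[Set.Icc a b] t = ⊥ := fun h =>
    notMem_closure_iff_nhdsWithin_eq_bot.1 (by rwa [isClosed_Icc.closure_eq])
  rw [nhdsWithin_union, tendsto_sup]
  constructor
  · by_cases ht : t ∈ Set.Icc 0 T
    · refine (hf t ht).congr' ?_
      filter_upwards [self_mem_nhdsWithin] with s hs
      rw [concat_of_le hfg hs.2, concat_of_le hfg ht.2]
    · rw [hbot ht]; exact tendsto_bot
  · by_cases ht : t ∈ Set.Icc T (T + T')
    · have hshift : Tendsto (· - T) (𝓝[Set.Icc T (T + T')] t) (𝓝[Set.Icc 0 T'] (t - T)) := by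
        refine tendsto_nhdsWithin_of_tendsto_nhds_of_eventually_within _
          (((continuous_sub_right T).tendsto t).mono_left nhdsWithin_le_nhds) ?_
        filter_upwards [self_mem_nhdsWithin] with s hs
        exact ⟨by linarith [hs.1], by linarith [hs.2]⟩
      refine ((hg (t - T) ⟨by linarith [ht.1], by linarith [ht.2]⟩).comp hshift).congr' ?_
      filter_upwards [self_mem_nhdsWithin] with s hs
      rw [concat_of_ge _ _ hs.1, concat_of_ge _ _ ht.1]
      rfl
    · rw [hbot ht]; exact tendsto_bot

/-- `u' = f` on `[0, T]` in integrated form, with `f` integrable. This is the common shape of the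
flow equation and of the continuity equation tested against a function. -/
structure IsPrimitiveOn (T : ℝ) (u f : ℝ → V) : Prop where
  intervalIntegrable : IntervalIntegrable f volume 0 T
  eq_add_integral : ∀ t ∈ Set.Icc 0 T, u t = u 0 + ∫ s in (0 : ℝ)..t, f s

namespace IsPrimitiveOn

variable {u v f g : ℝ → V}

lemma of_hasDerivAt [CompleteSpace V] (hu : ∀ t, HasDerivAt u (f t) t) (hf : Continuous f)
    (T : ℝ) : IsPrimitiveOn T u f where
  intervalIntegrable := hf.intervalIntegrable _ _
  eq_add_integral t _ := by
    rw [intervalIntegral.integral_eq_sub_of_hasDerivAt (fun s _ => hu s)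
      (hf.intervalIntegrable _ _), add_sub_cancel]

lemma continuousOn (hT : 0 ≤ T) (h : IsPrimitiveOn T u f) : ContinuousOn u (Set.Icc 0 T) := by
  have hc := intervalIntegral.continuousOn_primitive_interval' h.intervalIntegrable
    Set.left_mem_uIcc
  rw [Set.uIcc_of_le hT] at hc
  exact (continuousOn_const.add hc).congr h.eq_add_integral

lemma trans (hT : 0 ≤ T) (hT' : 0 ≤ T') (hu : IsPrimitiveOn T u f) (hv : IsPrimitiveOn T' v g)
    (huv : v 0 = u T) : IsPrimitiveOn (T + T') (concat T u v) (concat T f g) := by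
  have hleft : ∀ t ≤ T, Set.EqOn (concat T f g) f (Set.Ioo 0 t) := fun t ht s hs =>
    concat_of_lt f g (hs.2.trans_le ht)
  have hright : ∀ t, Set.EqOn (concat T f g) (fun s => g (s - T)) (Set.Ioo T t) :=
    fun t s hs => concat_of_ge f g hs.1.le
  have hintL : IntervalIntegrable (concat T f g) volume 0 T :=
    hu.intervalIntegrable.congr_uIoo (by rw [Set.uIoo_of_le hT]; exact (hleft T le_rfl).symm)
  have hintR : IntervalIntegrable (concat T f g) volume T (T + T') := by
    have hshift := hv.intervalIntegrable.comp_sub_right T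
    rw [zero_add, add_comm T'] at hshift
    exact hshift.congr_uIoo
      (by rw [Set.uIoo_of_le (le_add_of_nonneg_right hT')]; exact (hright _).symm)
  refine ⟨hintL.trans hintR, fun t ht => ?_⟩
  rw [concat_of_le huv hT]
  rcases lt_or_ge t T with htT | htT
  · rw [concat_of_lt u v htT, hu.eq_add_integral t ⟨ht.1, htT.le⟩,
      intervalIntegral.integral_congr_Ioo_of_le ht.1 (hleft t htT.le)]
  · have hintR' : IntervalIntegrable (concat T f g) volume T t :=
      hintR.mono_set (by
        rw [Set.uIcc_of_le htT, Set.uIcc_of_le (htT.trans ht.2)]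
        exact Set.Icc_subset_Icc_right ht.2)
    rw [concat_of_ge u v htT, hv.eq_add_integral (t - T) ⟨by linarith, by linarith [ht.2]⟩, huv,
      hu.eq_add_integral T ⟨hT, le_rfl⟩, add_assoc,
      ← intervalIntegral.integral_add_adjacent_intervals hintL hintR',
      intervalIntegral.integral_congr_Ioo_of_le hT (hleft T le_rfl),
      intervalIntegral.integral_congr_Ioo_of_le htT (hright t),
      intervalIntegral.integral_comp_sub_right, sub_self]

end IsPrimitiveOn

lemma isPiecewiseConstant_const (hT : 0 < T) (θ : Param d) :
    IsPiecewiseConstant T fun _ => θ :=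
  ⟨1, ![0, T], fun _ => θ, by simp [Fin.strictMono_iff_lt_succ, hT], rfl, rfl, fun _ _ _ => rfl⟩

lemma IsPiecewiseConstant.trans {θ θ' : ℝ → Param d} (h : IsPiecewiseConstant T θ)
    (h' : IsPiecewiseConstant T' θ') : IsPiecewiseConstant (T + T') (concat T θ θ') := by
  obtain ⟨K, t, c, ht, ht0, htK, hc⟩ := h
  obtain ⟨K', t', c', ht', ht0', htK', hc'⟩ := h'
  obtain ⟨τ, hleft, hright⟩ : ∃ τ : Fin (K + K' + 1) → ℝ,
      (∀ i : Fin (K + 1), τ ⟨i, by omega⟩ = t i) ∧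
        ∀ i : Fin (K' + 1), τ ⟨K + i, by omega⟩ = T + t' i := by
    refine ⟨fun i => if h : (i : ℕ) < K then t ⟨i, by omega⟩ else T + t' ⟨i - K, by omega⟩,
      fun i => ?_, fun i => by simp⟩
    rcases (Fin.le_last i).lt_or_eq with hi | rfl
    · exact dif_pos hi
    · simp [htK, ht0']
  refine ⟨K + K', τ, Fin.append c c', Fin.strictMono_iff_lt_succ.2 ?_, (hleft 0).trans ht0,
    (hright (Fin.last K')).trans (by rw [htK']), ?_⟩ <;>
    refine Fin.addCases (fun i => ?_) (fun i => ?_)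
  · exact (hleft i.castSucc).trans_lt ((ht i.castSucc_lt_succ).trans_eq (hleft i.succ).symm)
  · exact (hright i.castSucc).trans_lt
      ((add_lt_add_right (ht' i.castSucc_lt_succ) T).trans_eq (hright i.succ).symm)
  · intro s hs
    have hs : s ∈ Set.Ico (t i.castSucc) (t i.succ) := by
      rw [← hleft i.castSucc, ← hleft i.succ]; exact hs
    have hsT : s < T := hs.2.trans_le (htK ▸ ht.monotone (Fin.le_last _))
    rw [concat_of_lt _ _ hsT, Fin.append_left, hc i s hs]
  · intro s hs
    have hs : s ∈ Set.Ico (T + t' i.castSucc) (T + t' i.succ) := by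
      rw [← hright i.castSucc, ← hright i.succ]; exact hs
    have hTs : T ≤ s :=
      (le_add_of_nonneg_right (ht0' ▸ ht'.monotone (Fin.zero_le _))).trans hs.1
    rw [concat_of_ge _ _ hTs, Fin.append_right, hc' i _ ⟨by linarith [hs.1], by linarith [hs.2]⟩]

end Concatenation

lemma integral_abs_sub_le {X : Type*} [MeasurableSpace X] {μ : Measure X} {f g h : X → ℝ}
    (hf : Integrable f μ) (hg : Integrable g μ) (hh : Integrable h μ) :
    ∫ x, |f x - h x| ∂μ ≤ (∫ x, |f x - g x| ∂μ) + ∫ x, |g x - h x| ∂μ := by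
  have hfg : Integrable (fun x => |f x - g x|) μ := (hf.sub hg).abs
  have hgh : Integrable (fun x => |g x - h x|) μ := (hg.sub hh).abs
  rw [← integral_add hfg hgh]
  exact integral_mono (hf.sub hh).abs (hfg.add hgh) fun x => abs_sub_le _ _ _

/-- The density at time `t` of a mass distribution with density `p` at time `0` which is
transported by the neuron `θ`. -/
noncomputable def flowDensity (θ : Param d) (p : 𝔼 → ℝ) (t : ℝ) : 𝔼 → ℝ :=
  pushDensity (flowHomeo θ t) (flowJac θ t) p

lemma flowDensity_apply (θ : Param d) (p : 𝔼 → ℝ) (t : ℝ) (y : 𝔼) :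
    flowDensity θ p t y = p (flowMap θ (-t) y) * flowJac θ t y := rfl

lemma flowDensity_zero (θ : Param d) (p : 𝔼 → ℝ) : flowDensity θ p 0 = p := by
  ext y; simp [flowDensity_apply, flowJac]

lemma flowDensity_add (θ : Param d) (p : 𝔼 → ℝ) (s t : ℝ) :
    flowDensity θ p (s + t) = flowDensity θ (flowDensity θ p s) t := by
  ext y
  have hJ : flowJac θ (s + t) y = flowJac θ s (flowMap θ (-t) y) * flowJac θ t y := by
    simp only [flowJac, nonneg_preact_flowMap_iff]
    split_ifs
    · rw [← Real.exp_add]; ring_nf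
    · rw [one_mul]
  simp only [flowDensity_apply, flowMap_flowMap, hJ, mul_assoc]
  ring_nf

lemma integrable_flowDensity (θ : Param d) {p : 𝔼 → ℝ} (hp : Integrable p) (t : ℝ) :
    Integrable (flowDensity θ p t) :=
  (hasJacobian_flowHomeo θ t).integrable_pushDensity hp

lemma integral_abs_flowDensity_sub (θ : Param d) (p q : 𝔼 → ℝ) (t : ℝ) :
    ∫ y, |flowDensity θ p t y - flowDensity θ q t y| = ∫ x, |p x - q x| := by
  rw [← (hasJacobian_flowHomeo θ t).integral_pushDensity fun x => |p x - q x|]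
  congr 1 with y
  rw [flowDensity_apply, flowDensity_apply, ← sub_mul, abs_mul, abs_of_pos (flowJac_pos θ t y)]
  rfl

lemma integral_mul_flowDensity (θ : Param d) (p ψ : 𝔼 → ℝ) (t : ℝ) :
    ∫ x, ψ x * flowDensity θ p t x = ∫ x, ψ (flowMap θ t x) * p x := by
  rw [← (hasJacobian_flowHomeo θ t).integral_pushDensity fun x => ψ (flowMap θ t x) * p x]
  congr 1 with y
  simp [pushDensity, flowMap_flowMap, flowDensity_apply, mul_assoc]

lemma flowDensity_le (θ : Param d) {p : 𝔼 → ℝ} {C : ℝ} (hp : ∀ x, |p x| ≤ C) {T t : ℝ}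
    (ht : |t| ≤ T) (x : 𝔼) : |flowDensity θ p t x| ≤ C * Real.exp (|rate θ| * T) := by
  have hJ : flowJac θ t x ≤ Real.exp (|rate θ| * T) := (flowJac_le θ t x).trans (by gcongr)
  rw [flowDensity_apply, abs_mul, abs_of_pos (flowJac_pos θ t x)]
  exact mul_le_mul (hp _) hJ (flowJac_pos θ t x).le ((abs_nonneg _).trans (hp x))

lemma continuous_flowDensity_time (θ : Param d) {g : 𝔼 → ℝ} (hg : Continuous g) (y : 𝔼) :
    Continuous fun t => flowDensity θ g t y := by
  have hJ : Continuous fun t => flowJac θ t y := by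
    unfold flowJac; split_ifs <;> fun_prop
  exact (hg.comp ((continuous_flowMap_time θ y).comp continuous_neg)).mul hJ

lemma exists_flowDensity_sub_le_indicator (θ : Param d) {g : 𝔼 → ℝ} (hg : Continuous g)
    (hc : HasCompactSupport g) : ∃ (S : Set 𝔼) (C : ℝ), IsCompact S ∧
      ∀ t ∈ Set.Icc (-1) 1, ∀ x, |flowDensity θ g t x - g x| ≤ S.indicator (fun _ => C) x := by
  obtain ⟨C, hC⟩ := hc.exists_bound_of_continuous hg
  set S := (fun z : ℝ × 𝔼 => flowMap θ z.1 z.2) '' (Set.Icc (-1) 1 ×ˢ tsupport g)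
  have hzero : ∀ t ∈ Set.Icc (-1 : ℝ) 1, ∀ x ∉ S, flowDensity θ g t x = 0 := by
    intro t ht x hx
    have hgx : g (flowMap θ (-t) x) = 0 := by
      by_contra h
      exact hx ⟨(t, flowMap θ (-t) x), ⟨ht, subset_tsupport _ h⟩, by simp [flowMap_flowMap]⟩
    rw [flowDensity_apply, hgx, zero_mul]
  refine ⟨S, C * Real.exp (|rate θ| * 1) + C,
    (isCompact_Icc.prod hc).image (continuous_flowMap_uncurry θ), fun t ht x => ?_⟩
  by_cases hx : x ∈ S
  · rw [Set.indicator_of_mem hx]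
    exact (abs_sub _ _).trans (add_le_add (flowDensity_le θ hC (abs_le.2 ht) x) (hC x))
  · have h0 := hzero 0 (by simp) x hx
    rw [flowDensity_zero] at h0
    simp [Set.indicator_of_notMem hx, hzero t ht x hx, h0]

lemma tendsto_flowDensity_zero_of_hasCompactSupport (θ : Param d) {g : 𝔼 → ℝ}
    (hg : Continuous g) (hc : HasCompactSupport g) :
    Tendsto (fun t => ∫ x, |flowDensity θ g t x - g x|) (𝓝 0) (𝓝 0) := by
  obtain ⟨S, C, hS, hle⟩ := exists_flowDensity_sub_le_indicator θ hg hc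
  have hmeas : ∀ t, Measurable (flowDensity θ g t) := fun t =>
    (hg.measurable.comp (flowHomeo θ t).symm.measurable).mul (measurable_flowJac θ t)
  have hlim : Tendsto (fun t => ∫ x, |flowDensity θ g t x - g x|) (𝓝 0)
      (𝓝 (∫ x, |flowDensity θ g 0 x - g x|)) := by
    refine tendsto_integral_filter_of_dominated_convergence (S.indicator fun _ => C)
      (Eventually.of_forall fun t => ((hmeas t).sub hg.measurable).abs.aestronglyMeasurable) ?_
      ((integrable_indicator_iff hS.measurableSet).2 (integrableOn_const hS.measure_lt_top.ne))
      (ae_of_all _ fun x =>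
        (((continuous_flowDensity_time θ hg x).sub continuous_const).abs).tendsto 0)
    filter_upwards [Icc_mem_nhds (show (-1 : ℝ) < 0 by norm_num) one_pos] with t ht
    exact ae_of_all _ fun x => (norm_abs_eq_norm _).trans_le (hle t ht x)
  simpa [flowDensity_zero] using hlim

lemma tendsto_flowDensity_zero (θ : Param d) {p : 𝔼 → ℝ} (hp : Integrable p) :
    Tendsto (fun t => ∫ x, |flowDensity θ p t x - p x|) (𝓝 0) (𝓝 0) := by
  rw [Metric.tendsto_nhds]
  intro ε hε
  obtain ⟨g, hgc, hpg, hg, hgi⟩ := hp.exists_hasCompactSupport_integral_sub_le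
    (show 0 < ε / 3 by positivity)
  filter_upwards [Metric.tendsto_nhds.1 (tendsto_flowDensity_zero_of_hasCompactSupport θ hg hgc)
    (ε / 3) (by positivity)] with t hgt
  simp only [Real.norm_eq_abs] at hpg
  rw [Real.dist_0_eq_abs, abs_of_nonneg (integral_nonneg fun _ => abs_nonneg _)] at hgt ⊢
  have hpt := integrable_flowDensity θ hp t
  have hgi' := integrable_flowDensity θ hgi t
  calc ∫ x, |flowDensity θ p t x - p x|
      ≤ (∫ x, |flowDensity θ p t x - flowDensity θ g t x|) + ∫ x, |flowDensity θ g t x - p x| :=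
        integral_abs_sub_le hpt hgi' hp
    _ ≤ (∫ x, |p x - g x|) + ((∫ x, |flowDensity θ g t x - g x|) + ∫ x, |g x - p x|) := by
        rw [integral_abs_flowDensity_sub]
        gcongr
        exact integral_abs_sub_le hgi' hgi hp
    _ < ε := by
        simp only [abs_sub_comm (g _) (p _)]
        linarith

lemma tendsto_flowDensity (θ : Param d) {p : 𝔼 → ℝ} (hp : Integrable p) (t : ℝ) :
    Tendsto (fun s => ∫ x, |flowDensity θ p s x - flowDensity θ p t x|) (𝓝 t) (𝓝 0) := by
  have hshift : Tendsto (· - t) (𝓝 t) (𝓝 0) := by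
    simpa using (continuous_sub_right t).tendsto t
  refine ((tendsto_flowDensity_zero θ (integrable_flowDensity θ hp t)).comp hshift).congr
    fun s => ?_
  simp only [Function.comp, ← flowDensity_add, add_sub_cancel]

section WeakForm

variable {φ p : EuclideanSpace ℝ (Fin d) → ℝ}

lemma continuous_flux (θ : Param d) (hφ : ContDiff ℝ ∞ φ) :
    Continuous fun x => fderiv ℝ φ x (velocity x θ) :=
  (hφ.continuous_fderiv (by simp)).clm_apply (continuous_velocity θ)

lemma exists_flux_bound (θ : Param d) (hφ : ContDiff ℝ ∞ φ) (hc : HasCompactSupport φ) :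
    ∃ C, ∀ x, ‖fderiv ℝ φ x (velocity x θ)‖ ≤ C := by
  refine HasCompactSupport.exists_bound_of_continuous
    ((hc.fderiv (𝕜 := ℝ)).mono fun x hx => ?_) (continuous_flux θ hφ)
  contrapose! hx
  simp only [Function.mem_support, not_not] at hx ⊢
  simp [hx]

lemma isPrimitiveOn_comp_flowMap (θ : Param d) (hφ : ContDiff ℝ ∞ φ) (T : ℝ) (x : 𝔼) :
    IsPrimitiveOn T (fun t => φ (flowMap θ t x))
      fun t => fderiv ℝ φ (flowMap θ t x) (velocity (flowMap θ t x) θ) :=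
  .of_hasDerivAt (fun t => (hφ.differentiable (by simp) _).hasFDerivAt.comp_hasDerivAt t
    (hasDerivAt_flowMap θ t x)) ((continuous_flux θ hφ).comp (continuous_flowMap_time θ x)) T

lemma integrable_flux_uncurry (θ : Param d) (hφ : ContDiff ℝ ∞ φ) (hc : HasCompactSupport φ)
    (hp : Integrable p) (t : ℝ) :
    Integrable (Function.uncurry fun s x =>
      fderiv ℝ φ (flowMap θ s x) (velocity (flowMap θ s x) θ) * p x)
      ((volume.restrict (Set.uIoc 0 t)).prod volume) := by
  obtain ⟨C, hC⟩ := exists_flux_bound θ hφ hc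
  have : IsFiniteMeasure (volume.restrict (Set.uIoc 0 t)) := ⟨by simp [Set.uIoc]⟩
  exact (hp.comp_snd _).bdd_mul (c := C)
    ((continuous_flux θ hφ).comp (continuous_flowMap_uncurry θ)).aestronglyMeasurable
    (ae_of_all _ fun z => hC _)

lemma isPrimitiveOn_integral_mul_flowDensity (θ : Param d) (hφ : ContDiff ℝ ∞ φ)
    (hc : HasCompactSupport φ) (hp : Integrable p) {T : ℝ} :
    IsPrimitiveOn T (fun t => ∫ x, φ x * flowDensity θ p t x)
      fun t => ∫ x, fderiv ℝ φ x (velocity x θ) * flowDensity θ p t x := by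
  simp_rw [integral_mul_flowDensity]
  refine ⟨intervalIntegrable_iff.2 (integrable_flux_uncurry θ hφ hc hp T).integral_prod_left,
    fun t ht => ?_⟩
  obtain ⟨C, hC⟩ := hc.exists_bound_of_continuous hφ.continuous
  have hint : ∀ s, Integrable fun x => φ (flowMap θ s x) * p x := fun s =>
    hp.bdd_mul (c := C) (hφ.continuous.comp (flowHomeo θ s).continuous).aestronglyMeasurable
      (ae_of_all _ fun _ => hC _)
  rw [intervalIntegral_integral_swap (integrable_flux_uncurry θ hφ hc hp t),
    ← sub_eq_iff_eq_add', ← integral_sub (hint t) (hint 0)]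
  congr 1 with x
  rw [intervalIntegral.integral_mul_const, ← sub_mul,
    ((isPrimitiveOn_comp_flowMap θ hφ t x).eq_add_integral t ⟨ht.1, le_rfl⟩), add_sub_cancel_left]

end WeakForm

/-- The control `θ` drives the identity to `F` in time `T`, along the flow `Φ`, and transports the
density `ρ₀` along the solution `ρ` of the continuity equation. -/
structure Steers (T : ℝ) (F : 𝔼 → 𝔼) (ρ₀ : 𝔼 → ℝ) (θ : ℝ → Param d) (Φ : ℝ → 𝔼 → 𝔼)
    (ρ : ℝ → 𝔼 → ℝ) : Prop where
  isPiecewiseConstant : IsPiecewiseConstant T θ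
  flow_zero : Φ 0 = id
  flow_end : Φ T = F
  isPrimitiveOn_flow : ∀ x, IsPrimitiveOn T (fun t => Φ t x) fun t => velocity (Φ t x) (θ t)
  density_zero : ρ 0 = ρ₀
  isBoundedDensity : ∀ t ∈ Set.Icc 0 T, IsBoundedDensity volume (ρ t)
  bounded : ∃ C, ∀ t ∈ Set.Icc 0 T, ∀ x, |ρ t x| ≤ C
  tendsto_density : ∀ t ∈ Set.Icc 0 T,
    Tendsto (fun s => ∫ x, |ρ s x - ρ t x|) (𝓝[Set.Icc 0 T] t) (𝓝 0)
  isPrimitiveOn_density : ∀ φ : 𝔼 → ℝ, ContDiff ℝ ∞ φ → HasCompactSupport φ →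
    IsPrimitiveOn T (fun t => ∫ x, φ x * ρ t x)
      fun t => ∫ x, fderiv ℝ φ x (velocity x (θ t)) * ρ t x
  map_eq : (densityMeasure ρ₀).map F = densityMeasure (ρ T)

namespace Steers

variable {T T' : ℝ} {F G : EuclideanSpace ℝ (Fin d) → EuclideanSpace ℝ (Fin d)}
  {ρ₀ : EuclideanSpace ℝ (Fin d) → ℝ} {θ θ' : ℝ → Param d}
  {Φ Ψ : ℝ → EuclideanSpace ℝ (Fin d) → EuclideanSpace ℝ (Fin d)}
  {ρ ρ' : ℝ → EuclideanSpace ℝ (Fin d) → ℝ}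

lemma isFlow (hT : 0 ≤ T) (h : Steers T F ρ₀ θ Φ ρ) : IsFlow T θ Φ := fun x =>
  ⟨(h.isPrimitiveOn_flow x).continuousOn hT, fun t ht => by
    simpa only [h.flow_zero, id] using (h.isPrimitiveOn_flow x).eq_add_integral t ht⟩

lemma isContinuitySolution (h : Steers T F ρ₀ θ Φ ρ) : IsContinuitySolution T θ ρ₀ ρ where
  integrable t ht := (h.isBoundedDensity t ht).integrable
  bounded := h.bounded.imp fun _ hC t ht => ae_of_all _ (hC t ht)
  continuous := h.tendsto_density
  initial := by rw [h.density_zero]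
  weak φ hφ hc := by
    simpa only [h.density_zero] using (h.isPrimitiveOn_density φ hφ hc).eq_add_integral

lemma flowMap (θ : Param d) (hT : 0 < T) (h₀ : IsBoundedDensity volume ρ₀) :
    Steers T (flowMap θ T) ρ₀ (fun _ => θ) (flowMap θ) (flowDensity θ ρ₀) where
  isPiecewiseConstant := isPiecewiseConstant_const hT θ
  flow_zero := funext (flowMap_zero θ)
  flow_end := rfl
  isPrimitiveOn_flow x := .of_hasDerivAt (fun t => hasDerivAt_flowMap θ t x)
    ((continuous_velocity θ).comp (continuous_flowMap_time θ x)) T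
  density_zero := flowDensity_zero θ ρ₀
  isBoundedDensity t _ := h₀.push (hasJacobian_flowHomeo θ t)
  bounded := by
    obtain ⟨C, hC⟩ := h₀.bounded
    have hC : ∀ x, |ρ₀ x| ≤ C := fun x => (abs_of_nonneg (h₀.nonneg x)).trans_le (hC x)
    exact ⟨_, fun t ht => flowDensity_le θ hC ((abs_of_nonneg ht.1).trans_le ht.2)⟩
  tendsto_density t _ := (tendsto_flowDensity θ h₀.integrable t).mono_left nhdsWithin_le_nhds
  isPrimitiveOn_density _ hφ hc := isPrimitiveOn_integral_mul_flowDensity θ hφ hc h₀.integrable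
  map_eq := (hasJacobian_flowHomeo θ T).map_withDensity h₀.measurable

lemma trans (hT : 0 < T) (hT' : 0 ≤ T') (hF : Measurable F) (hG : Measurable G)
    (h : Steers T F ρ₀ θ Φ ρ) (h' : Steers T' G (ρ T) θ' Ψ ρ') :
    Steers (T + T') (G ∘ F) ρ₀ (concat T θ θ') (concat T Φ fun t => Ψ t ∘ F)
      (concat T ρ ρ') where
  isPiecewiseConstant := h.isPiecewiseConstant.trans h'.isPiecewiseConstant
  flow_zero := (concat_of_lt _ _ hT).trans h.flow_zero
  flow_end := (concat_add _ _ hT').trans (by rw [h'.flow_end])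
  isPrimitiveOn_flow x := by
    convert (h.isPrimitiveOn_flow x).trans hT.le hT' (h'.isPrimitiveOn_flow (F x))
      (by rw [h'.flow_zero, h.flow_end, id]) using 2 with t t <;>
    · unfold concat; split_ifs <;> rfl
  density_zero := (concat_of_lt _ _ hT).trans h.density_zero
  isBoundedDensity := forall_concat h.isBoundedDensity h'.isBoundedDensity
  bounded := by
    obtain ⟨C, hC⟩ := h.bounded
    obtain ⟨C', hC'⟩ := h'.bounded
    exact ⟨max C C', forall_concat
      (P := fun p : 𝔼 → ℝ => ∀ x, |p x| ≤ max C C')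
      (fun t ht x => (hC t ht x).trans (le_max_left _ _))
      fun t ht x => (hC' t ht x).trans (le_max_right _ _)⟩
  tendsto_density t _ := tendsto_concat (fun p q => ∫ x, |p x - q x|) h'.density_zero
    h.tendsto_density h'.tendsto_density t
  isPrimitiveOn_density φ hφ hc := by
    convert (h.isPrimitiveOn_density φ hφ hc).trans hT.le hT' (h'.isPrimitiveOn_density φ hφ hc)
      (by rw [h'.density_zero]) using 2 with t t <;>
    · unfold concat; split_ifs <;> rfl
  map_eq := by
    rw [concat_add _ _ hT', ← h'.map_eq, ← h.map_eq, Measure.map_map hG hF]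

end Steers

/-- `F` is reached by a piecewise constant control in every positive time, whatever the initial
density is. -/
def Steerable (F : 𝔼 → 𝔼) : Prop :=
  ∀ T : ℝ, 0 < T → ∀ ρ₀ : 𝔼 → ℝ, IsBoundedDensity volume ρ₀ → ∃ θ Φ ρ, Steers T F ρ₀ θ Φ ρ

lemma steerable_flowMap (θ : Param d) (t : ℝ) : Steerable (flowMap θ t) := by
  intro T hT ρ₀ h₀
  rw [← div_mul_cancel₀ t hT.ne', ← flowMap_smul]
  exact ⟨_, _, _, .flowMap _ hT h₀⟩

lemma Steerable.comp {F G : 𝔼 → 𝔼} (hG : Steerable G) (hF : Steerable F) (hGm : Measurable G)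
    (hFm : Measurable F) : Steerable (G ∘ F) := by
  intro T hT ρ₀ h₀
  obtain ⟨θ, Φ, ρ, h⟩ := hF (T / 2) (half_pos hT) ρ₀ h₀
  obtain ⟨θ', Ψ, ρ', h'⟩ := hG (T / 2) (half_pos hT) (ρ (T / 2))
    (h.isBoundedDensity _ ⟨(half_pos hT).le, le_rfl⟩)
  exact ⟨_, _, _, add_halves T ▸ h.trans (half_pos hT) (half_pos hT).le hFm hGm h'⟩

variable (d) in
/-- The group of homeomorphisms generated by the flow maps of single neurons. -/
def flowGroup : Subgroup (𝔼 ≃ₜ 𝔼) :=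
  Subgroup.closure (Set.range fun z : Param d × ℝ => flowHomeo z.1 z.2)

lemma flowHomeo_mem (θ : Param d) (t : ℝ) : flowHomeo θ t ∈ flowGroup d :=
  Subgroup.subset_closure ⟨(θ, t), rfl⟩

lemma flowHomeo_inv (θ : Param d) (t : ℝ) : (flowHomeo θ t)⁻¹ = flowHomeo θ (-t) := by
  ext1 x; rfl

lemma flowGroup_induction {P : (𝔼 ≃ₜ 𝔼) → Prop} (one : P 1)
    (mul : ∀ (θ : Param d) (t : ℝ) F, P F → P (flowHomeo θ t * F))
    {F : 𝔼 ≃ₜ 𝔼} (hF : F ∈ flowGroup d) : P F := by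
  refine Subgroup.closure_induction_left (p := fun F _ => P F) one ?_ ?_ hF
  · rintro _ ⟨⟨θ, t⟩, rfl⟩ F _ h
    exact mul θ t F h
  · rintro _ ⟨⟨θ, t⟩, rfl⟩ F _ h
    rw [flowHomeo_inv]
    exact mul θ (-t) F h

lemma steerable_of_mem {F : 𝔼 ≃ₜ 𝔼} (hF : F ∈ flowGroup d) : Steerable F := by
  refine flowGroup_induction (P := fun F => Steerable F) ?_ (fun θ t F h =>
    (steerable_flowMap θ t).comp h (flowHomeo θ t).measurable F.measurable) hF
  convert steerable_flowMap (0 : Param d) 0 using 1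
  ext1 x
  rw [flowMap_zero]
  rfl

/-! ### Relative entropy of densities -/

section RelativeEntropy

variable {X : Type*} [MeasurableSpace X] {μ : Measure X} {p q r : X → ℝ}

lemma withDensity_ofReal_eq_withDensity_div (hp : Measurable p) (hr : Measurable r)
    (hr0 : ∀ x, 0 < r x) :
    (μ.withDensity fun x => ENNReal.ofReal (p x)) =
      (μ.withDensity fun x => ENNReal.ofReal (r x)).withDensity
        fun x => ENNReal.ofReal (p x / r x) := by
  have hpr : Measurable fun x => ENNReal.ofReal (p x / r x) := by fun_prop
  rw [← withDensity_mul _ hr.ennreal_ofReal hpr]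
  congr 1
  ext1 x
  rw [Pi.mul_apply, ← ENNReal.ofReal_mul (hr0 x).le, mul_div_cancel₀ _ (hr0 x).ne']

lemma withDensity_ofReal_absolutelyContinuous (hp : Measurable p) (hr : Measurable r)
    (hr0 : ∀ x, 0 < r x) :
    (μ.withDensity fun x => ENNReal.ofReal (p x)) ≪ μ.withDensity fun x => ENNReal.ofReal (r x) :=
  withDensity_ofReal_eq_withDensity_div (μ := μ) hp hr hr0 ▸ withDensity_absolutelyContinuous _ _

lemma IsDensity.rnDeriv_withDensity_ofReal (hp : Measurable p) (hr : IsDensity μ r)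
    (hr0 : ∀ x, 0 < r x) :
    (μ.withDensity fun x => ENNReal.ofReal (p x)).rnDeriv
        (μ.withDensity fun x => ENNReal.ofReal (r x))
      =ᵐ[μ.withDensity fun x => ENNReal.ofReal (r x)] fun x => ENNReal.ofReal (p x / r x) := by
  have hfin := isFiniteMeasure_withDensity_ofReal hr.integrable.2
  rw [withDensity_ofReal_eq_withDensity_div hp hr.measurable hr0]
  exact Measure.rnDeriv_withDensity _ (hp.div hr.measurable).ennreal_ofReal

lemma IsDensity.klDiv_eq_lintegral (hp : IsDensity μ p) (hr : IsDensity μ r)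
    (hr0 : ∀ x, 0 < r x) :
    klDiv (μ.withDensity fun x => ENNReal.ofReal (p x))
        (μ.withDensity fun x => ENNReal.ofReal (r x)) =
      ∫⁻ x, ENNReal.ofReal (r x * klFun (p x / r x)) ∂μ := by
  have hfin_p := isFiniteMeasure_withDensity_ofReal hp.integrable.2
  have hfin_r := isFiniteMeasure_withDensity_ofReal hr.integrable.2
  have hac := withDensity_ofReal_absolutelyContinuous (μ := μ) hp.measurable hr.measurable hr0
  have hrn := hr.rnDeriv_withDensity_ofReal hp.measurable hr0
  have hdiv : Measurable fun x => p x / r x := hp.measurable.div hr.measurable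
  set ν := μ.withDensity fun x => ENNReal.ofReal (p x)
  set ξ := μ.withDensity fun x => ENNReal.ofReal (r x) with hξ
  calc klDiv ν ξ
      = ∫⁻ x, ENNReal.ofReal (klFun (ν.rnDeriv ξ x).toReal) ∂ξ :=
        klDiv_eq_lintegral_klFun_of_ac hac
    _ = ∫⁻ x, ENNReal.ofReal (klFun (p x / r x)) ∂ξ := by
        refine lintegral_congr_ae (hrn.mono fun x hx => ?_)
        simp only [hx, ENNReal.toReal_ofReal (div_nonneg (hp.nonneg x) (hr0 x).le)]
    _ = ∫⁻ x, ENNReal.ofReal (r x * klFun (p x / r x)) ∂μ := by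
        have hm : Measurable fun x => ENNReal.ofReal (klFun (p x / r x)) :=
          (measurable_klFun.comp hdiv).ennreal_ofReal
        rw [hξ, lintegral_withDensity_eq_lintegral_mul _ hr.measurable.ennreal_ofReal hm]
        exact lintegral_congr fun x => (ENNReal.ofReal_mul (hr0 x).le).symm

lemma IsDensity.llr_withDensity_ofReal (hp : IsDensity μ p) (hr : IsDensity μ r)
    (hr0 : ∀ x, 0 < r x) :
    llr (μ.withDensity fun x => ENNReal.ofReal (p x)) (μ.withDensity fun x => ENNReal.ofReal (r x))
      =ᵐ[μ.withDensity fun x => ENNReal.ofReal (p x)] fun x => Real.log (p x / r x) := by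
  have hac := withDensity_ofReal_absolutelyContinuous (μ := μ) hp.measurable hr.measurable hr0
  filter_upwards [hac.ae_le (hr.rnDeriv_withDensity_ofReal hp.measurable hr0)] with x hx
  rw [llr, hx, ENNReal.toReal_ofReal (div_nonneg (hp.nonneg x) (hr0 x).le)]

lemma IsDensity.integrable_mul_log_div (hp : IsDensity μ p) (hr : IsDensity μ r)
    (hr0 : ∀ x, 0 < r x)
    (hkl : klDiv (μ.withDensity fun x => ENNReal.ofReal (p x))
      (μ.withDensity fun x => ENNReal.ofReal (r x)) ≠ ⊤) :
    Integrable (fun x => p x * Real.log (p x / r x)) μ := by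
  have hint := (integrable_congr (hp.llr_withDensity_ofReal hr hr0)).1 (klDiv_ne_top_iff.1 hkl).2
  rw [integrable_withDensity_iff_integrable_smul' hp.measurable.ennreal_ofReal
    (ae_of_all _ fun _ => ENNReal.ofReal_lt_top)] at hint
  simpa only [ENNReal.toReal_ofReal (hp.nonneg _), smul_eq_mul] using hint

lemma IsDensity.withDensity_ofReal_univ (hp : IsDensity μ p) :
    μ.withDensity (fun x => ENNReal.ofReal (p x)) Set.univ = ENNReal.ofReal (∫ x, p x ∂μ) := by
  rw [withDensity_apply _ MeasurableSet.univ, setLIntegral_univ,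
    ofReal_integral_eq_lintegral_ofReal hp.integrable (ae_of_all _ hp.nonneg)]

lemma IsDensity.integral_mul_log_div (hp : IsDensity μ p) (hr : IsDensity μ r)
    (hr0 : ∀ x, 0 < r x) (hpr : ∫ x, p x ∂μ = ∫ x, r x ∂μ) :
    ∫ x, p x * Real.log (p x / r x) ∂μ =
      (klDiv (μ.withDensity fun x => ENNReal.ofReal (p x))
        (μ.withDensity fun x => ENNReal.ofReal (r x))).toReal := by
  have hfin_p := isFiniteMeasure_withDensity_ofReal hp.integrable.2
  have hfin_r := isFiniteMeasure_withDensity_ofReal hr.integrable.2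
  rw [toReal_klDiv_of_measure_eq
      (withDensity_ofReal_absolutelyContinuous hp.measurable hr.measurable hr0)
      (by rw [hp.withDensity_ofReal_univ, hr.withDensity_ofReal_univ, hpr]),
    integral_congr_ae (hp.llr_withDensity_ofReal hr hr0),
    integral_withDensity_eq_integral_toReal_smul hp.measurable.ennreal_ofReal
      (ae_of_all _ fun _ => ENNReal.ofReal_lt_top)]
  simp only [ENNReal.toReal_ofReal (hp.nonneg _), smul_eq_mul]

lemma mul_klFun_div_le {q r H : ℝ} (hq : 0 ≤ q) (hqH : q ≤ H) (hr : 0 < r) :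
    r * klFun (q / r) ≤ H ^ 2 + H * |Real.log r| + r := by
  rcases hq.eq_or_lt with rfl | hq0
  · simp only [zero_div, klFun_zero, mul_one]
    have := mul_nonneg hqH (abs_nonneg (Real.log r))
    nlinarith [sq_nonneg H]
  · have hkl : r * klFun (q / r) = q * Real.log q + q * -Real.log r + r - q := by
      rw [klFun_apply, Real.log_div hq0.ne' hr.ne']
      field_simp
      ring
    have hqq : q * Real.log q ≤ H ^ 2 :=
      calc q * Real.log q ≤ q * q := by gcongr; exact Real.log_le_self hq
        _ ≤ H ^ 2 := by nlinarith
    have hqr : q * -Real.log r ≤ H * |Real.log r| :=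
      calc q * -Real.log r ≤ q * |Real.log r| := by gcongr; exact neg_le_abs _
        _ ≤ H * |Real.log r| := by gcongr
    linarith

lemma tendsto_klDiv_withDensity_ofReal {p : ℕ → X → ℝ} {H : X → ℝ} (hp : ∀ n, IsDensity μ (p n))
    (hpH : ∀ n x, p n x ≤ H x) (hq : IsDensity μ q)
    (hpq : ∀ᵐ x ∂μ, Tendsto (fun n => p n x) atTop (𝓝 (q x)))
    (hr : IsDensity μ r) (hr0 : ∀ x, 0 < r x)
    (hH : Integrable (fun x => H x ^ 2) μ) (hHr : Integrable (fun x => H x * |Real.log (r x)|) μ) :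
    Tendsto (fun n => klDiv (μ.withDensity fun x => ENNReal.ofReal (p n x))
        (μ.withDensity fun x => ENNReal.ofReal (r x))) atTop
      (𝓝 (klDiv (μ.withDensity fun x => ENNReal.ofReal (q x))
        (μ.withDensity fun x => ENNReal.ofReal (r x)))) := by
  simp_rw [fun n => (hp n).klDiv_eq_lintegral hr hr0, hq.klDiv_eq_lintegral hr hr0]
  refine tendsto_lintegral_of_dominated_convergence
    (fun x => ENNReal.ofReal (H x ^ 2 + H x * |Real.log (r x)| + r x)) (fun n => ?_)
    (fun n => ae_of_all _ fun x => ENNReal.ofReal_le_ofReal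
      (mul_klFun_div_le ((hp n).nonneg x) (hpH n x) (hr0 x)))
    ((hH.add hHr).add hr.integrable).lintegral_lt_top.ne ?_
  · exact (hr.measurable.mul
      (measurable_klFun.comp ((hp n).measurable.div hr.measurable))).ennreal_ofReal
  · filter_upwards [hpq] with x hx
    exact ENNReal.tendsto_ofReal
      (((continuous_klFun.tendsto _).comp (hx.div_const _)).const_mul _)

lemma klFun_mul_le {η t u : ℝ} (ht : 0 ≤ t) (hu : Real.exp (-η) ≤ u) (hu' : u ≤ Real.exp η) :
    klFun (u * t) ≤ Real.exp η * klFun t + Real.exp η * η * t + (1 - Real.exp (-η)) := by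
  have hu0 : 0 < u := (Real.exp_pos _).trans_le hu
  have hlog : Real.log u ≤ η := (Real.log_le_iff_le_exp hu0).2 hu'
  have hη0 : 0 ≤ η := by
    have := Real.exp_le_exp.1 (hu.trans hu')
    linarith
  have hmul : klFun (u * t) = u * klFun t + u * Real.log u * t + (1 - u) := by
    rcases ht.eq_or_lt with rfl | ht
    · simp [klFun_zero]
    · rw [klFun_apply, klFun_apply, Real.log_mul hu0.ne' ht.ne']
      ring
  have hulog : u * Real.log u ≤ Real.exp η * η :=
    (mul_le_mul_of_nonneg_left hlog hu0.le).trans (mul_le_mul_of_nonneg_right hu' hη0)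
  rw [hmul]
  gcongr
  exact klFun_nonneg ht

lemma mul_klFun_div_le_of_ratio {p q r η : ℝ} (hη : 0 ≤ η) (hq : 0 ≤ q) (hr : 0 < r)
    (hqp : Real.exp (-η) * q ≤ p) (hpq : p ≤ Real.exp η * q) :
    r * klFun (p / r) ≤
      Real.exp η * (r * klFun (q / r)) + (Real.exp η * η * q + (1 - Real.exp (-η)) * r) := by
  obtain ⟨u, hu, hu', rfl⟩ : ∃ u, Real.exp (-η) ≤ u ∧ u ≤ Real.exp η ∧ p = u * q := by
    rcases hq.eq_or_lt with rfl | hq0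
    · exact ⟨1, by simpa using hη, by simpa using hη, by linarith⟩
    · exact ⟨p / q, (le_div_iff₀ hq0).2 hqp, (div_le_iff₀ hq0).2 hpq,
        (div_mul_cancel₀ _ hq0.ne').symm⟩
  rw [mul_div_assoc]
  refine (mul_le_mul_of_nonneg_left (klFun_mul_le (div_nonneg hq hr.le) hu hu') hr.le).trans_eq ?_
  field_simp
  ring

lemma IsDensity.klDiv_le_of_ratio {η : ℝ} (hη : 0 ≤ η) (hp : IsDensity μ p) (hq : IsDensity μ q)
    (hr : IsDensity μ r) (hr0 : ∀ x, 0 < r x) (hqp : ∀ x, Real.exp (-η) * q x ≤ p x)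
    (hpq : ∀ x, p x ≤ Real.exp η * q x) :
    klDiv (μ.withDensity fun x => ENNReal.ofReal (p x))
        (μ.withDensity fun x => ENNReal.ofReal (r x)) ≤
      ENNReal.ofReal (Real.exp η) * klDiv (μ.withDensity fun x => ENNReal.ofReal (q x))
          (μ.withDensity fun x => ENNReal.ofReal (r x)) +
        ENNReal.ofReal (Real.exp η * η * (∫ x, q x ∂μ) + (1 - Real.exp (-η)) * ∫ x, r x ∂μ) := by
  have hη1 : 0 ≤ 1 - Real.exp (-η) := by simpa using hη
  have hqi := hq.integrable.const_mul (Real.exp η * η)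
  have hri := hr.integrable.const_mul (1 - Real.exp (-η))
  have hqri : Integrable (fun x => Real.exp η * η * q x + (1 - Real.exp (-η)) * r x) μ :=
    hqi.add hri
  have hnonneg : ∀ x, 0 ≤ Real.exp η * η * q x + (1 - Real.exp (-η)) * r x := fun x =>
    add_nonneg (mul_nonneg (by positivity) (hq.nonneg x)) (mul_nonneg hη1 (hr0 x).le)
  have hm : Measurable fun x => ENNReal.ofReal (r x * klFun (q x / r x)) :=
    (hr.measurable.mul (measurable_klFun.comp (hq.measurable.div hr.measurable))).ennreal_ofReal
  rw [hp.klDiv_eq_lintegral hr hr0, hq.klDiv_eq_lintegral hr hr0, ← integral_const_mul,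
    ← integral_const_mul, ← integral_add hqi hri,
    ofReal_integral_eq_lintegral_ofReal hqri (ae_of_all _ hnonneg),
    ← lintegral_const_mul _ hm, ← lintegral_add_left (hm.const_mul _)]
  refine lintegral_mono fun x => ?_
  rw [← ENNReal.ofReal_mul (Real.exp_pos η).le, ← ENNReal.ofReal_add _ (hnonneg x)]
  · exact ENNReal.ofReal_le_ofReal
      (mul_klFun_div_le_of_ratio hη (hq.nonneg x) (hr0 x) (hqp x) (hpq x))
  · exact mul_nonneg (Real.exp_pos η).le
      (mul_nonneg (hr0 x).le (klFun_nonneg (div_nonneg (hq.nonneg x) (hr0 x).le)))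

lemma mul_klFun_div_le_of_le_mul {p r K : ℝ} (hp : 0 ≤ p) (hr : 0 < r) (hpr : p ≤ K * r) :
    r * klFun (p / r) ≤ p * Real.log K + (r - p) := by
  rcases hp.eq_or_lt with rfl | hp0
  · simp [klFun_zero]
  · have hlog : Real.log (p / r) ≤ Real.log K :=
      Real.log_le_log (div_pos hp0 hr) ((div_le_iff₀ hr).2 hpr)
    calc r * klFun (p / r) = p * Real.log (p / r) + (r - p) := by
          rw [klFun_apply]
          field_simp
          ring
      _ ≤ p * Real.log K + (r - p) := by gcongr

lemma IsDensity.klDiv_le_of_le_mul {K : ℝ} (hp : IsDensity μ p) (hr : IsDensity μ r)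
    (hr0 : ∀ x, 0 < r x) (hpr : ∀ x, p x ≤ K * r x) :
    klDiv (μ.withDensity fun x => ENNReal.ofReal (p x))
        (μ.withDensity fun x => ENNReal.ofReal (r x)) ≤
      ENNReal.ofReal ((∫ x, p x ∂μ) * Real.log K + ((∫ x, r x ∂μ) - ∫ x, p x ∂μ)) := by
  have hle : ∀ x, r x * klFun (p x / r x) ≤ p x * Real.log K + (r x - p x) := fun x =>
    mul_klFun_div_le_of_le_mul (hp.nonneg x) (hr0 x) (hpr x)
  have hpi := hp.integrable.mul_const (Real.log K)
  have hrpi : Integrable (fun x => r x - p x) μ := hr.integrable.sub hp.integrable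
  have hi : Integrable (fun x => p x * Real.log K + (r x - p x)) μ := hpi.add hrpi
  have hnonneg : ∀ x, 0 ≤ p x * Real.log K + (r x - p x) := fun x =>
    (mul_nonneg (hr0 x).le (klFun_nonneg (div_nonneg (hp.nonneg x) (hr0 x).le))).trans (hle x)
  rw [hp.klDiv_eq_lintegral hr hr0, ← integral_mul_const,
    ← integral_sub hr.integrable hp.integrable, ← integral_add hpi hrpi,
    ofReal_integral_eq_lintegral_ofReal hi (ae_of_all _ hnonneg)]
  exact lintegral_mono fun x => ENNReal.ofReal_le_ofReal (hle x)

end RelativeEntropy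

/-! ### Densities with Gaussian decay -/

section Gaussian

variable {V : Type*} [NormedAddCommGroup V] [InnerProductSpace ℝ V] [FiniteDimensional ℝ V]
  [MeasurableSpace V] [BorelSpace V] {c : ℝ}

lemma integrable_exp_neg_mul_norm_sq (hc : 0 < c) :
    Integrable fun x : V => Real.exp (-(c * ‖x‖ ^ 2)) := by
  have h := (GaussianFourier.integrable_cexp_neg_mul_sq_norm_add
    (V := V) (b := (c : ℂ)) (by simpa using hc) 0 0).norm
  refine h.congr (ae_of_all _ fun x => ?_)
  simp only [zero_mul, add_zero, Complex.norm_exp]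
  congr 1
  rw [← Complex.ofReal_pow, neg_mul, ← Complex.ofReal_mul, ← Complex.ofReal_neg, Complex.ofReal_re]

lemma integrable_norm_sq_mul_exp_neg_mul_norm_sq (hc : 0 < c) :
    Integrable fun x : V => ‖x‖ ^ 2 * Real.exp (-(c * ‖x‖ ^ 2)) := by
  refine ((integrable_exp_neg_mul_norm_sq (half_pos hc)).const_mul (2 / c)).mono'
    (by fun_prop) (ae_of_all _ fun x => ?_)
  rw [Real.norm_of_nonneg (by positivity)]
  have hexp : c / 2 * ‖x‖ ^ 2 ≤ Real.exp (c / 2 * ‖x‖ ^ 2) := by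
    linarith [Real.add_one_le_exp (c / 2 * ‖x‖ ^ 2)]
  calc ‖x‖ ^ 2 * Real.exp (-(c * ‖x‖ ^ 2))
      = 2 / c * (c / 2 * ‖x‖ ^ 2) * Real.exp (-(c * ‖x‖ ^ 2)) := by field_simp
    _ ≤ 2 / c * Real.exp (c / 2 * ‖x‖ ^ 2) * Real.exp (-(c * ‖x‖ ^ 2)) := by gcongr
    _ = 2 / c * Real.exp (-(c / 2 * ‖x‖ ^ 2)) := by
        rw [mul_assoc, ← Real.exp_add]
        ring_nf

end Gaussian

variable {p q r : EuclideanSpace ℝ (Fin d) → ℝ} {C c : ℝ}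

/-- Nonnegative measurable functions bounded by `C e^{-c |x|²}`: this decay is preserved by the flow
maps, up to the constants, and supplies the dominating functions for relative entropies. -/
structure HasGaussianBound (C c : ℝ) (p : 𝔼 → ℝ) : Prop where
  measurable : Measurable p
  nonneg : ∀ x, 0 ≤ p x
  le : ∀ x, p x ≤ C * Real.exp (-(c * ‖x‖ ^ 2))

namespace HasGaussianBound

lemma const_nonneg (hp : HasGaussianBound C c p) : 0 ≤ C := by
  simpa using (hp.nonneg 0).trans (hp.le 0)

lemma isBoundedDensity (hc : 0 < c) (hp : HasGaussianBound C c p) : IsBoundedDensity volume p where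
  measurable := hp.measurable
  nonneg := hp.nonneg
  integrable := by
    refine ((integrable_exp_neg_mul_norm_sq hc).const_mul C).mono'
      hp.measurable.aestronglyMeasurable (ae_of_all _ fun x => ?_)
    rw [Real.norm_of_nonneg (hp.nonneg x)]
    exact hp.le x
  bounded := ⟨C, fun x => (hp.le x).trans (mul_le_of_le_one_right hp.const_nonneg
    (Real.exp_le_one_iff.2 (neg_nonpos.2 (by positivity))))⟩

lemma isDensity (hc : 0 < c) (hp : HasGaussianBound C c p) : IsDensity volume p :=
  (hp.isBoundedDensity hc).toIsDensity

lemma mono {C' c' : ℝ} (hp : HasGaussianBound C c p) (hC : C ≤ C') (hc : c' ≤ c) :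
    HasGaussianBound C' c' p where
  measurable := hp.measurable
  nonneg := hp.nonneg
  le x := by
    have hC' := hp.const_nonneg.trans hC
    refine (hp.le x).trans ?_
    gcongr

lemma const_mul {κ : ℝ} (hp : HasGaussianBound C c p) (hκ : 0 ≤ κ) :
    HasGaussianBound (κ * C) c fun x => κ * p x where
  measurable := hp.measurable.const_mul κ
  nonneg x := mul_nonneg hκ (hp.nonneg x)
  le x := by
    rw [mul_assoc]
    exact mul_le_mul_of_nonneg_left (hp.le x) hκ

lemma push {F : 𝔼 ≃ₜ 𝔼} {J : 𝔼 → ℝ} {B L D : ℝ} (hp : HasGaussianBound C c p) (hc : 0 ≤ c)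
    (hF : HasJacobian volume F J) (hB : ∀ y, J y ≤ B) (hL : 0 < L)
    (hFL : ∀ x, ‖F x‖ ≤ L * ‖x‖ + D) :
    HasGaussianBound (C * Real.exp (c * D ^ 2 / L ^ 2) * B) (c / (2 * L ^ 2))
      (pushDensity F J p) where
  measurable := (hp.measurable.comp F.symm.measurable).mul hF.measurable
  nonneg y := mul_nonneg (hp.nonneg _) (hF.nonneg _)
  le y := by
    have hC := hp.const_nonneg
    have hy : ‖y‖ ^ 2 ≤ 2 * (L ^ 2 * ‖F.symm y‖ ^ 2 + D ^ 2) := by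
      have h := hFL (F.symm y)
      rw [F.apply_symm_apply] at h
      nlinarith [sq_nonneg (L * ‖F.symm y‖ - D), norm_nonneg y]
    have hexp : -(c * ‖F.symm y‖ ^ 2) ≤ c * D ^ 2 / L ^ 2 + -(c / (2 * L ^ 2) * ‖y‖ ^ 2) := by
      have hmul := mul_le_mul_of_nonneg_left hy (by positivity : 0 ≤ c / (2 * L ^ 2))
      have heq : c / (2 * L ^ 2) * (2 * (L ^ 2 * ‖F.symm y‖ ^ 2 + D ^ 2)) =
          c * ‖F.symm y‖ ^ 2 + c * D ^ 2 / L ^ 2 := by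
        field_simp
      linarith
    calc p (F.symm y) * J y
        ≤ (C * (Real.exp (c * D ^ 2 / L ^ 2) * Real.exp (-(c / (2 * L ^ 2) * ‖y‖ ^ 2)))) * B := by
          refine mul_le_mul ((hp.le _).trans ?_) (hB y) (hF.nonneg y) (by positivity)
          rw [← Real.exp_add]
          gcongr
      _ = _ := by ring

lemma of_tendsto {p : ℕ → 𝔼 → ℝ} (hp : ∀ n, HasGaussianBound C c (p n))
    (hpq : ∀ x, Tendsto (fun n => p n x) atTop (𝓝 (q x))) : HasGaussianBound C c q where
  measurable :=
    measurable_of_tendsto_metrizable (fun n => (hp n).measurable) (tendsto_pi_nhds.2 hpq)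
  nonneg x := ge_of_tendsto' (hpq x) fun n => (hp n).nonneg x
  le x := le_of_tendsto' (hpq x) fun n => (hp n).le x

end HasGaussianBound

/-- Nonnegative measurable functions with Gaussian decay of an unspecified rate. -/
def HasGaussianDecay (p : 𝔼 → ℝ) : Prop :=
  ∃ C c : ℝ, 0 < c ∧ HasGaussianBound C c p

lemma norm_flowMap_le (θ : Param d) (t : ℝ) (x : 𝔼) :
    ‖flowMap θ t x‖ ≤ (1 + |expInt (rate θ) t| * ‖θ.2.1‖ * ‖θ.1‖) * ‖x‖ +
      |expInt (rate θ) t| * |θ.2.2| * ‖θ.1‖ := by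
  have hmax : |max (preact θ x) 0| ≤ ‖θ.2.1‖ * ‖x‖ + |θ.2.2| := by
    rw [abs_of_nonneg (le_max_right _ _)]
    exact max_le (add_le_add (real_inner_le_norm _ _) (le_abs_self _)) (by positivity)
  calc ‖flowMap θ t x‖ ≤ ‖x‖ + |expInt (rate θ) t| * |max (preact θ x) 0| * ‖θ.1‖ := by
        refine (norm_add_le _ _).trans ?_
        rw [norm_smul, Real.norm_eq_abs, abs_mul]
    _ ≤ ‖x‖ + |expInt (rate θ) t| * (‖θ.2.1‖ * ‖x‖ + |θ.2.2|) * ‖θ.1‖ := by gcongr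
    _ = _ := by ring

lemma exists_norm_le_of_mem {F : 𝔼 ≃ₜ 𝔼} (hF : F ∈ flowGroup d) :
    ∃ L D : ℝ, 0 < L ∧ ∀ x, ‖F x‖ ≤ L * ‖x‖ + D := by
  refine flowGroup_induction (P := fun F => ∃ L D : ℝ, 0 < L ∧ ∀ x, ‖F x‖ ≤ L * ‖x‖ + D) ?_ ?_ hF
  · exact ⟨1, 0, one_pos, fun x => by simp⟩
  · rintro θ t F ⟨L, D, hL, hFL⟩
    set A := 1 + |expInt (rate θ) t| * ‖θ.2.1‖ * ‖θ.1‖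
    refine ⟨A * L, A * D + |expInt (rate θ) t| * |θ.2.2| * ‖θ.1‖, by positivity, fun x => ?_⟩
    calc ‖flowMap θ t (F x)‖ ≤ A * ‖F x‖ + |expInt (rate θ) t| * |θ.2.2| * ‖θ.1‖ :=
          norm_flowMap_le θ t (F x)
      _ ≤ A * (L * ‖x‖ + D) + |expInt (rate θ) t| * |θ.2.2| * ‖θ.1‖ := by
          gcongr
          exact hFL x
      _ = _ := by ring

lemma exists_hasJacobian_of_mem {F : 𝔼 ≃ₜ 𝔼} (hF : F ∈ flowGroup d) :
    ∃ J, HasJacobian volume F J := by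
  refine flowGroup_induction (P := fun F => ∃ J, HasJacobian volume F J) ?_ ?_ hF
  · exact ⟨_, .of_measurePreserving (MeasurePreserving.id volume)⟩
  · rintro θ t F ⟨J, hJ⟩
    exact ⟨_, hJ.trans (hasJacobian_flowHomeo θ t)⟩

lemma quasiMeasurePreserving_symm_of_mem {F : 𝔼 ≃ₜ 𝔼} (hF : F ∈ flowGroup d) :
    Measure.QuasiMeasurePreserving F.symm volume volume := by
  obtain ⟨J, hJ⟩ := exists_hasJacobian_of_mem (inv_mem hF)
  refine ⟨F.symm.measurable, ?_⟩
  have hmap : volume.map F.symm = volume.withDensity fun y => ENNReal.ofReal (J y) := hJ.map_eq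
  rw [hmap]
  exact withDensity_absolutelyContinuous _ _

/-! ### The infimal relative entropy along the group of flow maps -/

/-- Everywhere positive target densities whose logarithm is integrable against Gaussians. -/
structure IsTarget (r : 𝔼 → ℝ) : Prop extends IsDensity volume r where
  pos : ∀ x, 0 < r x
  integrable_log : ∀ c : ℝ, 0 < c → Integrable fun x => Real.exp (-(c * ‖x‖ ^ 2)) * |Real.log (r x)|

/-- The infimum of the relative entropies `KL(F_# (p dx) ‖ r dx)` over the flow maps `F`. -/
noncomputable def klInf (r p : 𝔼 → ℝ) : ENNReal :=
  ⨅ F ∈ flowGroup d, klDiv ((densityMeasure p).map F) (densityMeasure r)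

lemma map_densityMeasure {F : 𝔼 ≃ₜ 𝔼} {J : 𝔼 → ℝ} (hF : HasJacobian volume F J)
    (hp : Measurable p) :
    (densityMeasure p).map F = densityMeasure (pushDensity F J p) :=
  hF.map_withDensity hp

lemma klInf_le_klDiv (r p : 𝔼 → ℝ) :
    klInf r p ≤ klDiv (densityMeasure p) (densityMeasure r) :=
  (iInf₂_le 1 (one_mem _)).trans_eq (congrArg (klDiv · _) Measure.map_id)

lemma klInf_le_klInf_pushDensity {J : 𝔼 → ℝ} {F : 𝔼 ≃ₜ 𝔼} (hp : Measurable p)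
    (hF : F ∈ flowGroup d) (hJ : HasJacobian volume F J) :
    klInf r p ≤ klInf r (pushDensity F J p) := by
  refine le_iInf₂ fun G hG => ?_
  rw [← map_densityMeasure hJ hp, Measure.map_map G.measurable F.measurable]
  exact iInf₂_le (G * F) (mul_mem hG hF)

lemma tendsto_klDiv_densityMeasure {p : ℕ → 𝔼 → ℝ} (hr : IsTarget r) (hc : 0 < c)
    (hp : ∀ n, HasGaussianBound C c (p n)) (hq : HasGaussianBound C c q)
    (hpq : ∀ᵐ x, Tendsto (fun n => p n x) atTop (𝓝 (q x))) :
    Tendsto (fun n => klDiv (densityMeasure (p n)) (densityMeasure r)) atTop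
      (𝓝 (klDiv (densityMeasure q) (densityMeasure r))) := by
  refine tendsto_klDiv_withDensity_ofReal (H := fun x => C * Real.exp (-(c * ‖x‖ ^ 2)))
    (fun n => (hp n).isDensity hc) (fun n => (hp n).le) (hq.isDensity hc) hpq hr.toIsDensity hr.pos
    ?_ ?_
  · have hsq : (fun x : 𝔼 => (C * Real.exp (-(c * ‖x‖ ^ 2))) ^ 2) =
        fun x => C ^ 2 * Real.exp (-((2 * c) * ‖x‖ ^ 2)) := by
      ext x
      rw [mul_pow, ← Real.exp_nat_mul]
      congr 2
      push_cast
      ring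
    rw [hsq]
    exact (integrable_exp_neg_mul_norm_sq (by positivity)).const_mul _
  · simp only [mul_assoc]
    exact (hr.integrable_log c hc).const_mul C

lemma le_klInf_of_tendsto {p : ℕ → 𝔼 → ℝ} {k : ENNReal} (hr : IsTarget r) (hc : 0 < c)
    (hp : ∀ n, HasGaussianBound C c (p n)) (hq : HasGaussianBound C c q)
    (hpq : ∀ᵐ x, Tendsto (fun n => p n x) atTop (𝓝 (q x))) (hk : ∀ n, k ≤ klInf r (p n)) :
    k ≤ klInf r q := by
  refine le_iInf₂ fun G hG => ?_
  obtain ⟨J, hJ⟩ := exists_hasJacobian_of_mem hG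
  obtain ⟨L, D, hL, hGL⟩ := exists_norm_le_of_mem hG
  obtain ⟨B, hB⟩ := hJ.bounded
  have hlim : ∀ᵐ y, Tendsto (fun n => pushDensity G J (p n) y) atTop (𝓝 (pushDensity G J q y)) :=
    ((quasiMeasurePreserving_symm_of_mem hG).ae hpq).mono fun y hy => hy.mul_const _
  have hkl := tendsto_klDiv_densityMeasure hr (by positivity)
    (fun n => (hp n).push hc.le hJ hB hL hGL) (hq.push hc.le hJ hB hL hGL) hlim
  rw [map_densityMeasure hJ hq.measurable]
  refine ge_of_tendsto' hkl fun n => ?_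
  rw [← map_densityMeasure hJ (hp n).measurable]
  exact (hk n).trans (iInf₂_le G hG)

lemma klInf_le_of_ratio {η : ℝ} (hr : IsTarget r) (hη : 0 ≤ η) (hp : IsDensity volume p)
    (hq : IsDensity volume q) (hqp : ∀ x, Real.exp (-η) * q x ≤ p x)
    (hpq : ∀ x, p x ≤ Real.exp η * q x) :
    klInf r p ≤ ENNReal.ofReal (Real.exp η) * klInf r q +
      ENNReal.ofReal (Real.exp η * η * (∫ x, q x) + (1 - Real.exp (-η)) * ∫ x, r x) := by
  have he0 : ENNReal.ofReal (Real.exp η) ≠ 0 := by simp [Real.exp_pos]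
  have he : ENNReal.ofReal (Real.exp η) ≠ ⊤ := ENNReal.ofReal_ne_top
  rw [← tsub_le_iff_right, ← ENNReal.div_le_iff' he0 he]
  refine le_iInf₂ fun G hG => ?_
  rw [ENNReal.div_le_iff' he0 he, tsub_le_iff_right]
  refine (iInf₂_le G hG).trans ?_
  obtain ⟨J, hJ⟩ := exists_hasJacobian_of_mem hG
  rw [map_densityMeasure hJ hp.measurable, map_densityMeasure hJ hq.measurable,
    ← hJ.integral_pushDensity q]
  refine (hp.push hJ).klDiv_le_of_ratio hη (hq.push hJ) hr.toIsDensity hr.pos (fun y => ?_)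
    fun y => ?_
  · rw [pushDensity, pushDensity, ← mul_assoc]
    exact mul_le_mul_of_nonneg_right (hqp _) (hJ.nonneg y)
  · rw [pushDensity, pushDensity, ← mul_assoc]
    exact mul_le_mul_of_nonneg_right (hpq _) (hJ.nonneg y)

variable {i j : Fin d}

/-! ### Shears and stretchings in a coordinate direction -/

/-- The shear `x ↦ x + f x • e_j`, with `f` independent of the `j`-th coordinate, is a volume
preserving element of the flow group. -/
structure IsFlowShear (j : Fin d) (f : 𝔼 → ℝ) : Prop where
  apply_add_smul : ∀ x (s : ℝ), f (x + s • EuclideanSpace.single j (1 : ℝ)) = f x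
  exists_mem : ∃ F ∈ flowGroup d, (∀ x, F x = x + f x • EuclideanSpace.single j (1 : ℝ)) ∧
    MeasurePreserving F volume volume

namespace IsFlowShear

lemma zero (j : Fin d) : IsFlowShear j fun _ => 0 where
  apply_add_smul _ _ := rfl
  exists_mem := ⟨1, one_mem _, fun x => by simp, MeasurePreserving.id volume⟩

lemma add {f g : 𝔼 → ℝ} (hf : IsFlowShear j f) (hg : IsFlowShear j g) :
    IsFlowShear j fun x => f x + g x where
  apply_add_smul x s := by rw [hf.apply_add_smul, hg.apply_add_smul]
  exists_mem := by
    obtain ⟨F, hF, hFx, hFm⟩ := hf.exists_mem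
    obtain ⟨G, hG, hGx, hGm⟩ := hg.exists_mem
    refine ⟨F * G, mul_mem hF hG, fun x => ?_, hFm.comp hGm⟩
    change F (G x) = _
    rw [hFx, hGx, hf.apply_add_smul]
    module

lemma sum {ι : Type*} (s : Finset ι) {f : ι → 𝔼 → ℝ} (hf : ∀ i ∈ s, IsFlowShear j (f i)) :
    IsFlowShear j fun x => ∑ i ∈ s, f i x := by
  classical
  induction s using Finset.induction_on with
  | empty => simpa using zero j
  | insert i s hi ih =>
    simp only [Finset.sum_insert hi]
    exact (hf i (Finset.mem_insert_self i s)).add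
      (ih fun k hk => hf k (Finset.mem_insert_of_mem hk))

end IsFlowShear

lemma isFlowShear_relu (hij : i ≠ j) (κ s b : ℝ) :
    IsFlowShear j fun x => κ * max (s * x i + b) 0 := by
  set θ : Param d :=
    (κ • EuclideanSpace.single j (1 : ℝ), s • EuclideanSpace.single i (1 : ℝ), b) with hθ
  have hrate : rate θ = 0 := by
    simp [rate, hθ, inner_smul_left, inner_smul_right, EuclideanSpace.inner_single_left, hij]
  have hpre : ∀ x, preact θ x = s * x i + b := fun x => by
    simp [preact, hθ, inner_smul_left, EuclideanSpace.inner_single_left]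
  refine ⟨fun x t => by simp [hij], flowHomeo θ 1, flowHomeo_mem θ 1, fun x => ?_,
    (flowHomeo θ 1).measurable, ?_⟩
  · rw [flowHomeo_apply, flowMap, hrate, hpre, expInt_zero_left]
    module
  · rw [(hasJacobian_flowHomeo θ 1).map_eq]
    simp [flowJac, hrate]

/-- Replace the `j`-th coordinate of `x` by `v`. -/
noncomputable def setCoord (j : Fin d) (x : 𝔼) (v : ℝ) : 𝔼 :=
  x + (v - x j) • EuclideanSpace.single j (1 : ℝ)

@[simp] lemma setCoord_same (j : Fin d) (x : 𝔼) (v : ℝ) : setCoord j x v j = v := by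
  simp [setCoord]

lemma setCoord_of_ne (h : i ≠ j) (x : 𝔼) (v : ℝ) : setCoord j x v i = x i := by
  simp [setCoord, h]

@[simp] lemma setCoord_self (j : Fin d) (x : 𝔼) : setCoord j x (x j) = x := by simp [setCoord]

@[simp] lemma setCoord_setCoord (j : Fin d) (x : 𝔼) (v w : ℝ) :
    setCoord j (setCoord j x v) w = setCoord j x w := by
  rw [setCoord, setCoord_same, setCoord, setCoord]
  module

/-- The neuron with weight and direction `e_j` and threshold `a`. -/
noncomputable def coordParam (j : Fin d) (a : ℝ) : Param d :=
  (EuclideanSpace.single j (1 : ℝ), EuclideanSpace.single j (1 : ℝ), -a)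

lemma rate_coordParam (j : Fin d) (a : ℝ) : rate (coordParam j a) = 1 := by
  simp [rate, coordParam]

lemma preact_coordParam (j : Fin d) (a : ℝ) (x : 𝔼) : preact (coordParam j a) x = x j - a := by
  simp [preact, coordParam, EuclideanSpace.inner_single_left, sub_eq_add_neg]

/-- Expand by `e^κ`, in the direction `e_j`, the part of the space above the graph of `N + a`. -/
noncomputable def stretchAbove (j : Fin d) (N : 𝔼 → ℝ) (a κ : ℝ) (x : 𝔼) : 𝔼 :=
  x + ((Real.exp κ - 1) * max (x j - N x - a) 0) • EuclideanSpace.single j (1 : ℝ)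

lemma flowMap_coordParam (j : Fin d) (a κ : ℝ) (x : 𝔼) :
    flowMap (coordParam j a) κ x = stretchAbove j 0 a κ x := by
  have h := mul_expInt 1 κ
  rw [one_mul, one_mul] at h
  rw [flowMap, rate_coordParam, preact_coordParam, h, stretchAbove, Pi.zero_apply, sub_zero]
  rfl

lemma norm_stretchAbove_le {N : 𝔼 → ℝ} (hN : ∀ x, 0 ≤ N x) (a κ : ℝ) (x : 𝔼) :
    ‖stretchAbove j N a κ x‖ ≤
      (1 + |Real.exp κ - 1|) * ‖x‖ + |Real.exp κ - 1| * |a| := by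
  have hmax : max (x j - N x - a) 0 ≤ ‖x‖ + |a| := by
    refine max_le ?_ (by positivity)
    have hxj : x j ≤ ‖x‖ := (le_abs_self _).trans (PiLp.norm_apply_le x j)
    linarith [hN x, neg_le_abs a]
  calc ‖stretchAbove j N a κ x‖ ≤ ‖x‖ + |Real.exp κ - 1| * max (x j - N x - a) 0 := by
        refine (norm_add_le _ _).trans_eq ?_
        rw [norm_smul, PiLp.norm_single, norm_one, mul_one, norm_mul, Real.norm_eq_abs,
          Real.norm_of_nonneg (le_max_right _ _)]
    _ ≤ ‖x‖ + |Real.exp κ - 1| * (‖x‖ + |a|) := by gcongr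
    _ = _ := by ring

lemma IsFlowShear.exists_stretchAbove {N : 𝔼 → ℝ} (hN : IsFlowShear j fun x => -N x) (a κ : ℝ) :
    ∃ F ∈ flowGroup d, (∀ x, F x = stretchAbove j N a κ x) ∧
      (∀ y, F.symm y = stretchAbove j N a (-κ) y) ∧
      HasJacobian volume F fun y => if a ≤ y j - N y then Real.exp (-κ) else 1 := by
  obtain ⟨G, hG, hGx, hGm⟩ := hN.exists_mem
  have hadd : ∀ x (s : ℝ), N (x + s • EuclideanSpace.single j (1 : ℝ)) = N x := fun x s =>
    neg_injective (hN.apply_add_smul x s)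
  have hGs : ∀ y, G.symm y = y + N y • EuclideanSpace.single j (1 : ℝ) := fun y => by
    rw [Homeomorph.symm_apply_eq, hGx, hadd]
    module
  have hGj : ∀ x, G x j = x j - N x := fun x => by simp [hGx, sub_eq_add_neg]
  have hconj : ∀ t x, G.symm (flowMap (coordParam j a) t (G x)) = stretchAbove j N a t x := by
    intro t x
    rw [hGs, flowMap_coordParam, stretchAbove, hadd, hGj, hGx, hadd, Pi.zero_apply, sub_zero,
      stretchAbove]
    module
  refine ⟨(G.trans (flowHomeo (coordParam j a) κ)).trans G.symm,
    mul_mem (inv_mem hG) (mul_mem (flowHomeo_mem _ _) hG), hconj κ, hconj (-κ), ?_⟩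
  convert ((HasJacobian.of_measurePreserving hGm).trans (hasJacobian_flowHomeo _ _)).trans
    (.of_measurePreserving (F := G.symm) (hGm.symm G.toMeasurableEquiv)) using 1
  ext y
  simp only [pushDensity, Homeomorph.symm_symm, flowJac, preact_coordParam, rate_coordParam, hGj,
    one_mul, mul_one, sub_nonneg]

/-! ### Stretching the part of a density above a cell -/

/-- The coordinates other than the `j`-th one lie in the half-open box. -/
def InCell (j : Fin d) (A B : Fin d → ℝ) (x : 𝔼) : Prop :=
  ∀ i, i ≠ j → A i ≤ x i ∧ x i < B i

/-- A sum of ReLUs of the coordinates other than the `j`-th one: it vanishes at the points of the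
cell for large `m` and diverges elsewhere. -/
noncomputable def cellPenalty (j : Fin d) (A B : Fin d → ℝ) (m : ℝ) (x : 𝔼) : ℝ :=
  ∑ i ∈ Finset.univ.erase j, (m ^ 2 * max (x i - B i + m⁻¹) 0 + m * max (A i - x i) 0)

lemma isFlowShear_neg_cellPenalty (j : Fin d) (A B : Fin d → ℝ) (m : ℝ) :
    IsFlowShear j fun x => -cellPenalty j A B m x := by
  have h : IsFlowShear j fun x => ∑ i ∈ Finset.univ.erase j,
      (-m ^ 2 * max (1 * x i + (m⁻¹ - B i)) 0 + -m * max (-1 * x i + A i) 0) :=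
    .sum _ fun i hi => (isFlowShear_relu (Finset.ne_of_mem_erase hi) _ _ _).add
      (isFlowShear_relu (Finset.ne_of_mem_erase hi) _ _ _)
  convert h using 2 with x
  rw [cellPenalty, ← Finset.sum_neg_distrib]
  refine Finset.sum_congr rfl fun i _ => ?_
  ring_nf

variable {A B : Fin d → ℝ}

lemma cellPenalty_nonneg {m : ℝ} (hm : 0 ≤ m) (x : 𝔼) : 0 ≤ cellPenalty j A B m x :=
  Finset.sum_nonneg fun i _ => by positivity

lemma eventually_cellPenalty_eq_zero {x : 𝔼} (hx : InCell j A B x) :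
    ∀ᶠ m : ℝ in atTop, cellPenalty j A B m x = 0 := by
  have h : ∀ i : Fin d, ∀ᶠ m : ℝ in atTop, i ≠ j →
      m ^ 2 * max (x i - B i + m⁻¹) 0 + m * max (A i - x i) 0 = 0 := by
    intro i
    by_cases hi : i = j
    · exact Eventually.of_forall fun m h => absurd hi h
    · have hB : 0 < B i - x i := by linarith [(hx i hi).2]
      filter_upwards [tendsto_inv_atTop_zero.eventually (gt_mem_nhds hB)] with m hm _
      rw [max_eq_right (by linarith), max_eq_right (by linarith [(hx i hi).1])]
      simp
  filter_upwards [eventually_all.2 h] with m hm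
  exact Finset.sum_eq_zero fun i hi => hm i (Finset.ne_of_mem_erase hi)

lemma le_cellPenalty (hij : i ≠ j) {m : ℝ} (hm : 0 ≤ m) (x : 𝔼) :
    m ^ 2 * max (x i - B i + m⁻¹) 0 + m * max (A i - x i) 0 ≤ cellPenalty j A B m x :=
  Finset.single_le_sum
    (f := fun i => m ^ 2 * max (x i - B i + m⁻¹) 0 + m * max (A i - x i) 0)
    (fun i _ => by positivity) (Finset.mem_erase.2 ⟨hij, Finset.mem_univ i⟩)

lemma tendsto_cellPenalty {x : 𝔼} (hx : ¬ InCell j A B x) :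
    Tendsto (fun m => cellPenalty j A B m x) atTop atTop := by
  simp only [InCell, not_forall, not_and_or, not_le, not_lt] at hx
  obtain ⟨i, hij, hA | hB⟩ := hx
  · refine tendsto_atTop_mono' _ ?_ (tendsto_id.atTop_mul_const (sub_pos.2 hA))
    filter_upwards [eventually_ge_atTop 0] with m hm
    calc m * (A i - x i) ≤ m * max (A i - x i) 0 := by gcongr; exact le_max_left _ _
      _ ≤ _ := le_add_of_nonneg_left (by positivity)
      _ ≤ cellPenalty j A B m x := le_cellPenalty hij hm x
  · refine tendsto_atTop_mono' _ ?_ tendsto_id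
    filter_upwards [eventually_gt_atTop 0] with m hm
    calc m = m ^ 2 * m⁻¹ := by field_simp
      _ ≤ m ^ 2 * max (x i - B i + m⁻¹) 0 := by
        gcongr
        exact le_max_of_le_left (by linarith)
      _ ≤ _ := le_add_of_nonneg_right (by positivity)
      _ ≤ cellPenalty j A B m x := le_cellPenalty hij hm.le x

/-- Contract the graph of `φ` on `[a, ∞)` by the factor `u` towards `a`, preserving integrals: this
is the push-forward of the density `φ` by the expansion of `[a, ∞)` by `u⁻¹`. -/
noncomputable def lineStretch (a u : ℝ) (φ : ℝ → ℝ) (s : ℝ) : ℝ :=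
  if a ≤ s then u * φ (a + u * (s - a)) else φ s

lemma lineStretch_of_le {a s : ℝ} (h : a ≤ s) (u : ℝ) (φ : ℝ → ℝ) :
    lineStretch a u φ s = u * φ (a + u * (s - a)) := if_pos h

lemma lineStretch_of_lt {a s : ℝ} (h : s < a) (u : ℝ) (φ : ℝ → ℝ) :
    lineStretch a u φ s = φ s := if_neg h.not_ge

lemma lineStretch_inv_lineStretch (a : ℝ) {u : ℝ} (hu : 0 < u) (φ : ℝ → ℝ) :
    lineStretch a u⁻¹ (lineStretch a u φ) = φ := by
  ext s
  rcases lt_or_ge s a with h | h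
  · rw [lineStretch_of_lt h, lineStretch_of_lt h]
  · have hs : 0 ≤ u⁻¹ * (s - a) := mul_nonneg (by positivity) (sub_nonneg.2 h)
    rw [lineStretch_of_le h, lineStretch_of_le (by linarith), inv_mul_cancel_left₀ hu.ne']
    congr 1
    field_simp
    ring

open Classical in
/-- Apply `lineStretch a u` to the density `p` along the lines in direction `e_j` that run inside
the cell. -/
noncomputable def stretch (j : Fin d) (A B : Fin d → ℝ) (a u : ℝ) (p : 𝔼 → ℝ) (y : 𝔼) : ℝ :=
  if InCell j A B y then lineStretch a u (fun s => p (setCoord j y s)) (y j) else p y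

lemma inCell_setCoord {x : 𝔼} {v : ℝ} : InCell j A B (setCoord j x v) ↔ InCell j A B x :=
  forall₂_congr fun i hi => by rw [setCoord_of_ne hi]

lemma stretch_of_inCell {y : 𝔼} (hy : InCell j A B y) (a u : ℝ) (p : 𝔼 → ℝ) :
    stretch j A B a u p y = lineStretch a u (fun s => p (setCoord j y s)) (y j) := if_pos hy

lemma stretch_of_not_inCell {y : 𝔼} (hy : ¬ InCell j A B y) (a u : ℝ) (p : 𝔼 → ℝ) :
    stretch j A B a u p y = p y := if_neg hy

lemma stretch_setCoord {y : 𝔼} (hy : InCell j A B y) (a u : ℝ) (p : 𝔼 → ℝ) (s : ℝ) :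
    stretch j A B a u p (setCoord j y s) = lineStretch a u (fun t => p (setCoord j y t)) s := by
  rw [stretch_of_inCell (inCell_setCoord.2 hy), setCoord_same]
  simp only [setCoord_setCoord]

lemma stretch_inv_stretch (j : Fin d) (A B : Fin d → ℝ) (a : ℝ) {u : ℝ} (hu : 0 < u) (p : 𝔼 → ℝ) :
    stretch j A B a u⁻¹ (stretch j A B a u p) = p := by
  ext y
  by_cases hy : InCell j A B y
  · rw [stretch_of_inCell hy]
    simp only [stretch_setCoord hy]
    rw [lineStretch_inv_lineStretch a hu, setCoord_self]
  · rw [stretch_of_not_inCell hy, stretch_of_not_inCell hy]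

lemma eventually_eq_stretch (j : Fin d) (A B : Fin d → ℝ) (a κ : ℝ) (p : 𝔼 → ℝ) (y : 𝔼) :
    ∀ᶠ m : ℝ in atTop, p (stretchAbove j (cellPenalty j A B m) a (-κ) y) *
        (if a ≤ y j - cellPenalty j A B m y then Real.exp (-κ) else 1) =
      stretch j A B a (Real.exp (-κ)) p y := by
  by_cases hy : InCell j A B y
  · filter_upwards [eventually_cellPenalty_eq_zero hy] with m hm
    rw [stretch_of_inCell hy, stretchAbove, hm, sub_zero]
    rcases lt_or_ge (y j) a with ha | ha
    · rw [lineStretch_of_lt ha, if_neg ha.not_ge, max_eq_right (by linarith)]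
      simp
    · rw [lineStretch_of_le ha, if_pos ha, max_eq_left (by linarith), mul_comm, setCoord]
      congr 4
      ring
  · filter_upwards [(tendsto_cellPenalty hy).eventually_gt_atTop (y j - a)] with m hm
    rw [stretch_of_not_inCell hy, stretchAbove, if_neg (by linarith), max_eq_right (by linarith)]
    simp

-- `stretch` is discontinuous across the walls of the cell, so it is reached only in the limit of an
-- infinite penalty.
lemma exists_tendsto_stretch (j : Fin d) (A B : Fin d → ℝ) (a : ℝ) {u : ℝ} (hu : 0 < u)
    (hp : HasGaussianDecay p) :
    ∃ (C c : ℝ) (q : ℕ → 𝔼 → ℝ), 0 < c ∧ (∀ n, HasGaussianBound C c (q n)) ∧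
      (∀ r n, klInf r p ≤ klInf r (q n)) ∧
      ∀ y, Tendsto (fun n => q n y) atTop (𝓝 (stretch j A B a u p y)) := by
  obtain ⟨C, c, hc, hp⟩ := hp
  obtain ⟨κ, rfl⟩ : ∃ κ, u = Real.exp (-κ) := ⟨-Real.log u, by rw [neg_neg, Real.exp_log hu]⟩
  choose F hF hFx hFs hFJ using fun n : ℕ =>
    (isFlowShear_neg_cellPenalty j A B ((n : ℝ) + 1)).exists_stretchAbove a κ
  have hJ : ∀ n y, (if a ≤ y j - cellPenalty j A B ((n : ℝ) + 1) y then Real.exp (-κ) else 1) ≤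
      Real.exp |κ| := by
    intro n y
    split_ifs
    · exact Real.exp_le_exp.2 (neg_le_abs κ)
    · exact Real.one_le_exp (abs_nonneg κ)
  refine ⟨_, _, fun n => pushDensity (F n) _ p, ?_, fun n => hp.push hc.le (hFJ n) (hJ n)
    (D := |Real.exp κ - 1| * |a|) (by positivity : 0 < 1 + |Real.exp κ - 1|) fun x => ?_,
    fun r n => klInf_le_klInf_pushDensity hp.measurable (hF n) (hFJ n), fun y => ?_⟩
  · positivity
  · rw [hFx]
    exact norm_stretchAbove_le (cellPenalty_nonneg (by positivity)) a κ x
  · simp only [pushDensity, hFs]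
    exact tendsto_const_nhds.congr' (((tendsto_atTop_add_const_right _ 1
      tendsto_natCast_atTop_atTop).eventually (eventually_eq_stretch j A B a κ p y)).mono
        fun n hn => hn.symm)

lemma HasGaussianDecay.stretch (j : Fin d) (A B : Fin d → ℝ) (a : ℝ) {u : ℝ} (hu : 0 < u)
    (hp : HasGaussianDecay p) : HasGaussianDecay (stretch j A B a u p) := by
  obtain ⟨C, c, q, hc, hq, -, hlim⟩ := exists_tendsto_stretch j A B a hu hp
  exact ⟨C, c, hc, .of_tendsto hq hlim⟩

lemma klInf_le_klInf_stretch (hr : IsTarget r) (j : Fin d) (A B : Fin d → ℝ) (a : ℝ) {u : ℝ}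
    (hu : 0 < u) (hp : HasGaussianDecay p) : klInf r p ≤ klInf r (stretch j A B a u p) := by
  obtain ⟨C, c, q, hc, hq, hle, hlim⟩ := exists_tendsto_stretch j A B a hu hp
  exact le_klInf_of_tendsto hr hc hq (.of_tendsto hq hlim) (ae_of_all _ hlim) (hle r)

lemma klInf_stretch (hr : IsTarget r) (j : Fin d) (A B : Fin d → ℝ) (a : ℝ) {u : ℝ} (hu : 0 < u)
    (hp : HasGaussianDecay p) : klInf r (stretch j A B a u p) = klInf r p := by
  refine le_antisymm ?_ (klInf_le_klInf_stretch hr j A B a hu hp)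
  have h := klInf_le_klInf_stretch hr j A B a (inv_pos.2 hu) (hp.stretch j A B a hu)
  rwa [stretch_inv_stretch j A B a hu] at h

/-! ### Boxes -/

/-- The half-open box `∏ [A i, B i)`. -/
def box (A B : Fin d → ℝ) : Set 𝔼 :=
  {x | ∀ i, A i ≤ x i ∧ x i < B i}

variable {f g : EuclideanSpace ℝ (Fin d) → ℝ} {η m : ℝ}

lemma mem_box_iff_inCell (j : Fin d) {x : 𝔼} :
    x ∈ box A B ↔ InCell j A B x ∧ A j ≤ x j ∧ x j < B j := by
  refine ⟨fun h => ⟨fun i _ => h i, h j⟩, fun h i => ?_⟩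
  rcases eq_or_ne i j with rfl | hi
  exacts [h.2, h.1 i hi]

lemma mem_box_update_right (hm : m ≤ B j) {x : 𝔼} :
    x ∈ box A (Function.update B j m) ↔ x ∈ box A B ∧ x j < m := by
  refine (Function.forall_update_iff B fun i b => A i ≤ x i ∧ x i < b).trans ?_
  rw [mem_box_iff_inCell j]
  exact ⟨fun h => ⟨⟨h.2, h.1.1, h.1.2.trans_le hm⟩, h.1.2⟩, fun h => ⟨⟨h.1.2.1, h.2⟩, h.1.1⟩⟩

lemma mem_box_update_left (hm : A j ≤ m) {x : 𝔼} :
    x ∈ box (Function.update A j m) B ↔ x ∈ box A B ∧ m ≤ x j := by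
  refine (Function.forall_update_iff A fun i a => a ≤ x i ∧ x i < B i).trans ?_
  rw [mem_box_iff_inCell j]
  exact ⟨fun h => ⟨⟨h.2, hm.trans h.1.1, h.1.2⟩, h.1.1⟩, fun h => ⟨⟨h.2, h.1.2.2⟩, h.1.1⟩⟩

lemma box_update_union (hA : A j ≤ m) (hB : m ≤ B j) :
    box A (Function.update B j m) ∪ box (Function.update A j m) B = box A B := by
  ext x
  rw [Set.mem_union, mem_box_update_right hB, mem_box_update_left hA, ← and_or_left]
  exact and_iff_left (lt_or_ge _ _)

lemma disjoint_box_update (hA : A j ≤ m) (hB : m ≤ B j) :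
    Disjoint (box A (Function.update B j m)) (box (Function.update A j m) B) :=
  Set.disjoint_left.2 fun _ hx hx' =>
    ((mem_box_update_right hB).1 hx).2.not_ge ((mem_box_update_left hA).1 hx').2

lemma box_eq_preimage (A B : Fin d → ℝ) :
    box A B = WithLp.ofLp ⁻¹' (Set.univ.pi fun i => Set.Ico (A i) (B i)) := by
  ext x
  simp [box]

lemma measurableSet_box (A B : Fin d → ℝ) : MeasurableSet (box A B) := by
  rw [box_eq_preimage]
  exact (PiLp.volume_preserving_ofLp (Fin d)).measurable
    (MeasurableSet.univ_pi fun i => measurableSet_Ico)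

lemma volume_box (A B : Fin d → ℝ) : volume (box A B) = ∏ i, ENNReal.ofReal (B i - A i) := by
  rw [box_eq_preimage, (PiLp.volume_preserving_ofLp (Fin d)).measure_preimage
    (MeasurableSet.univ_pi fun i => measurableSet_Ico).nullMeasurableSet, Real.volume_pi_Ico]

lemma volume_box_ne_top (A B : Fin d → ℝ) : volume (box A B) ≠ ⊤ := by
  rw [volume_box]
  exact ENNReal.prod_ne_top fun i _ => ENNReal.ofReal_ne_top

lemma volume_box_ne_zero (hAB : ∀ i, A i < B i) : volume (box A B) ≠ 0 := by
  rw [volume_box]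
  exact Finset.prod_ne_zero_iff.2 fun i _ => by simpa using hAB i

lemma isBounded_box (A B : Fin d → ℝ) : Bornology.IsBounded (box A B) := by
  refine ((isCompact_Icc (a := A) (b := B)).image (PiLp.continuous_toLp 2 _)).isBounded.subset ?_
  exact fun x hx => ⟨WithLp.ofLp x, ⟨fun i => (hx i).1, fun i => (hx i).2.le⟩, rfl⟩

lemma lt_update_midpoint (hAB : ∀ i, A i < B i) (j : Fin d) :
    ∀ i, A i < Function.update B j ((A j + B j) / 2) i :=
  (Function.forall_update_iff B fun i b => A i < b).2
    ⟨by linarith [hAB j], fun i _ => hAB i⟩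

lemma update_midpoint_lt (hAB : ∀ i, A i < B i) (j : Fin d) :
    ∀ i, Function.update A j ((A j + B j) / 2) i < B i :=
  (Function.forall_update_iff A fun i a => a < B i).2
    ⟨by linarith [hAB j], fun i _ => hAB i⟩

lemma volume_box_update_midpoint (A B : Fin d → ℝ) (j : Fin d) :
    volume (box A (Function.update B j ((A j + B j) / 2))) =
      volume (box (Function.update A j ((A j + B j) / 2)) B) := by
  rw [volume_box, volume_box]
  refine Finset.prod_congr rfl fun i _ => ?_
  rcases eq_or_ne i j with rfl | hi
  · rw [Function.update_self, Function.update_self]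
    congr 1
    ring
  · rw [Function.update_of_ne hi, Function.update_of_ne hi]

lemma integral_pos_of_forall_pos {X : Type*} [MeasurableSpace X] {μ : Measure X} {f : X → ℝ}
    (hμ : μ ≠ 0) (hf : ∀ x, 0 < f x) (hfi : Integrable f μ) : 0 < ∫ x, f x ∂μ := by
  rw [integral_pos_iff_support_of_nonneg (fun x => (hf x).le) hfi,
    Function.support_eq_univ fun x => (hf x).ne']
  exact Measure.measure_univ_pos.2 hμ

lemma setIntegral_box_pos (hf : ∀ x, 0 < f x) (hfi : Integrable f) (hAB : ∀ i, A i < B i) :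
    0 < ∫ x in box A B, f x :=
  integral_pos_of_forall_pos (mt Measure.restrict_eq_zero.1 (volume_box_ne_zero hAB)) hf
    hfi.integrableOn

lemma setAverage_box_pos (hf : ∀ x, 0 < f x) (hfi : Integrable f) (hAB : ∀ i, A i < B i) :
    0 < ⨍ x in box A B, f x := by
  rw [setAverage_eq]
  exact smul_pos (inv_pos.2 (ENNReal.toReal_pos (volume_box_ne_zero hAB) (volume_box_ne_top A B)))
    (setIntegral_box_pos hf hfi hAB)

lemma setAverage_box_eq_midpoint (hfi : Integrable f) (hAB : ∀ i, A i < B i) (j : Fin d) :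
    ⨍ x in box A B, f x =
      ((⨍ x in box A (Function.update B j ((A j + B j) / 2)), f x) +
        ⨍ x in box (Function.update A j ((A j + B j) / 2)) B, f x) / 2 := by
  have hA : A j ≤ (A j + B j) / 2 := by linarith [hAB j]
  have hB : (A j + B j) / 2 ≤ B j := by linarith [hAB j]
  have hV : volume.real (box (Function.update A j ((A j + B j) / 2)) B) ≠ 0 :=
    (ENNReal.toReal_pos (volume_box_ne_zero (update_midpoint_lt hAB j))
      (volume_box_ne_top _ _)).ne'
  rw [← box_update_union hA hB, average_union (disjoint_box_update hA hB).aedisjoint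
    (measurableSet_box _ _).nullMeasurableSet (volume_box_ne_top _ _) (volume_box_ne_top _ _)
    hfi.integrableOn hfi.integrableOn]
  have hVe := congrArg ENNReal.toReal (volume_box_update_midpoint A B j)
  simp only [Measure.real, smul_eq_mul, hVe] at hV ⊢
  field_simp
  ring

/-! ### Splitting a box on which the density is constant -/

lemma lineStretch_split {a b v v₁ v₂ : ℝ} {φ : ℝ → ℝ} (hab : a < b) (hv₁ : 0 < v₁) (hv₂ : 0 < v₂)
    (hv : v = (v₁ + v₂) / 2) (hφ : ∀ s ∈ Set.Ico a b, φ s = v) (s : ℝ) :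
    lineStretch b (v / v₂) (lineStretch ((a + b) / 2) (v₂ / v₁) (lineStretch a (v₁ / v) φ)) s =
      if s ∈ Set.Ico a b then (if s < (a + b) / 2 then v₁ else v₂) else φ s := by
  have hv0 : 0 < v := by
    rw [hv]
    positivity
  obtain ⟨m, hm⟩ : ∃ m, m = (a + b) / 2 := ⟨_, rfl⟩
  have ham : a < m := by linarith
  rw [← hm]
  rcases lt_or_ge s a with hsa | hsa
  · rw [lineStretch_of_lt (by linarith), lineStretch_of_lt (by linarith), lineStretch_of_lt hsa,
      if_neg fun h => hsa.not_ge h.1]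
  rcases lt_or_ge s b with hsb | hsb
  · rw [if_pos ⟨hsa, hsb⟩, lineStretch_of_lt hsb]
    rcases lt_or_ge s m with hsm | hsm
    · have hlt : v₁ / v * (s - a) < b - a := by
        rw [div_mul_eq_mul_div, div_lt_iff₀ hv0]
        nlinarith
      have hge : 0 ≤ v₁ / v * (s - a) := mul_nonneg (by positivity) (sub_nonneg.2 hsa)
      rw [if_pos hsm, lineStretch_of_lt hsm, lineStretch_of_le hsa,
        hφ _ ⟨by linarith, by linarith⟩, div_mul_cancel₀ _ hv0.ne']
    · have hge : 0 ≤ v₂ / v₁ * (s - m) := mul_nonneg (by positivity) (sub_nonneg.2 hsm)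
      have hge' : 0 ≤ v₁ / v * (m + v₂ / v₁ * (s - m) - a) :=
        mul_nonneg (by positivity) (by linarith)
      have hlt : v₁ / v * (m + v₂ / v₁ * (s - m) - a) < b - a := by
        have heq : v₁ / v * (m + v₂ / v₁ * (s - m) - a) = (v₁ * (m - a) + v₂ * (s - m)) / v := by
          field_simp
          ring
        rw [heq, div_lt_iff₀ hv0]
        nlinarith
      rw [if_neg hsm.not_gt, lineStretch_of_le hsm, lineStretch_of_le (by linarith),
        hφ _ ⟨by linarith, by linarith⟩]
      field_simp
  · have hge : 0 ≤ v / v₂ * (s - b) := mul_nonneg (by positivity) (sub_nonneg.2 hsb)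
    have hge' : 0 ≤ v₂ / v₁ * (b + v / v₂ * (s - b) - m) :=
      mul_nonneg (by positivity) (by linarith)
    have heq : a + v₁ / v * (m + v₂ / v₁ * (b + v / v₂ * (s - b) - m) - a) = s := by
      rw [hv, hm]
      field_simp
      ring
    rw [if_neg fun h => hsb.not_gt h.2, lineStretch_of_le hsb, lineStretch_of_le (by linarith),
      lineStretch_of_le (by linarith), heq]
    field_simp

open Classical in
lemma stretch_split {v v₁ v₂ : ℝ} (hAB : A j < B j) (hv₁ : 0 < v₁) (hv₂ : 0 < v₂)
    (hv : v = (v₁ + v₂) / 2) (hp : ∀ x ∈ box A B, p x = v) :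
    stretch j A B (B j) (v / v₂) (stretch j A B ((A j + B j) / 2) (v₂ / v₁)
        (stretch j A B (A j) (v₁ / v) p)) =
      (box A B).piecewise (fun x => if x j < (A j + B j) / 2 then v₁ else v₂) p := by
  ext y
  by_cases hy : InCell j A B y
  · have hφ : ∀ s ∈ Set.Ico (A j) (B j), p (setCoord j y s) = v := fun s hs =>
      hp _ ((mem_box_iff_inCell j).2 ⟨inCell_setCoord.2 hy, by simpa using hs⟩)
    have hbox : y ∈ box A B ↔ y j ∈ Set.Ico (A j) (B j) :=
      (mem_box_iff_inCell j).trans (and_iff_right hy)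
    rw [stretch_of_inCell hy]
    simp only [stretch_setCoord hy, Set.piecewise, hbox]
    rw [lineStretch_split hAB hv₁ hv₂ hv hφ, setCoord_self]
  · rw [stretch_of_not_inCell hy, stretch_of_not_inCell hy, stretch_of_not_inCell hy,
      Set.piecewise_eq_of_notMem _ _ _ fun h => hy ((mem_box_iff_inCell j).1 h).1]

open Classical in
lemma klInf_split {v v₁ v₂ : ℝ} (hr : IsTarget r) (hAB : A j < B j) (hv₁ : 0 < v₁) (hv₂ : 0 < v₂)
    (hv : v = (v₁ + v₂) / 2) (hp : HasGaussianDecay p) (hpv : ∀ x ∈ box A B, p x = v) :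
    HasGaussianDecay
        ((box A B).piecewise (fun x => if x j < (A j + B j) / 2 then v₁ else v₂) p) ∧
      klInf r ((box A B).piecewise (fun x => if x j < (A j + B j) / 2 then v₁ else v₂) p) =
        klInf r p := by
  have hv0 : 0 < v := by
    rw [hv]
    positivity
  have hp₁ := hp.stretch j A B (A j) (div_pos hv₁ hv0)
  have hp₂ := hp₁.stretch j A B ((A j + B j) / 2) (div_pos hv₂ hv₁)
  rw [← stretch_split hAB hv₁ hv₂ hv hpv]
  refine ⟨hp₂.stretch j A B (B j) (div_pos hv0 hv₂), ?_⟩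
  rw [klInf_stretch hr j A B _ (div_pos hv0 hv₂) hp₂,
    klInf_stretch hr j A B _ (div_pos hv₂ hv₁) hp₁, klInf_stretch hr j A B _ (div_pos hv₁ hv0) hp]

/-! ### Step approximations -/

open Classical in
/-- A function `s` is a step approximation of `f` on a box if it agrees with `f` there up to a
factor `e^{±η}`, and if a density that is constant on the box, with the same mass there as `f`, can
be replaced by `s` on the box without changing its infimal relative entropy to `r`. -/
structure IsStepApprox (r : 𝔼 → ℝ) (η : ℝ) (f : 𝔼 → ℝ) (A B : Fin d → ℝ) (s : 𝔼 → ℝ) : Prop where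
  exp_neg_mul_le : ∀ x ∈ box A B, Real.exp (-η) * f x ≤ s x
  le_exp_mul : ∀ x ∈ box A B, s x ≤ Real.exp η * f x
  klInf_piecewise : ∀ p, HasGaussianDecay p → (∀ x ∈ box A B, p x = ⨍ y in box A B, f y) →
    HasGaussianDecay ((box A B).piecewise s p) ∧ klInf r ((box A B).piecewise s p) = klInf r p

lemma isStepApprox_setAverage (hfi : Integrable f) (hAB : ∀ i, A i < B i)
    (hosc : ∀ x ∈ box A B, ∀ y ∈ box A B, f y ≤ Real.exp η * f x) :
    IsStepApprox r η f A B fun _ => ⨍ y in box A B, f y := by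
  classical
  have hmem : ∀ x ∈ box A B,
      ⨍ y in box A B, f y ∈ Set.Icc (Real.exp (-η) * f x) (Real.exp η * f x) := fun x hx =>
    (convex_Icc _ _).set_average_mem isClosed_Icc (volume_box_ne_zero hAB) (volume_box_ne_top A B)
      ((ae_restrict_mem (measurableSet_box A B)).mono fun y hy =>
        ⟨by simpa only [Real.exp_neg] using (inv_mul_le_iff₀ (Real.exp_pos η)).2 (hosc y hy x hx),
          hosc x hx y hy⟩) hfi.integrableOn
  refine ⟨fun x hx => (hmem x hx).1, fun x hx => (hmem x hx).2, fun p hp hpf => ?_⟩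
  have heq : (box A B).piecewise (fun _ => ⨍ y in box A B, f y) p = p := by
    ext x
    by_cases hx : x ∈ box A B <;> simp [hx, hpf]
  rw [heq]
  exact ⟨hp, rfl⟩

lemma IsStepApprox.bisect {s₁ s₂ : EuclideanSpace ℝ (Fin d) → ℝ} (hr : IsTarget r)
    (hf : ∀ x, 0 < f x) (hfi : Integrable f) (hAB : ∀ i, A i < B i) (j : Fin d)
    (h₁ : IsStepApprox r η f A (Function.update B j ((A j + B j) / 2)) s₁)
    (h₂ : IsStepApprox r η f (Function.update A j ((A j + B j) / 2)) B s₂) :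
    IsStepApprox r η f A B fun x => if x j < (A j + B j) / 2 then s₁ x else s₂ x := by
  have hA : A j ≤ (A j + B j) / 2 := by linarith [hAB j]
  have hB : (A j + B j) / 2 ≤ B j := by linarith [hAB j]
  have hlow : ∀ x, x ∈ box A (Function.update B j ((A j + B j) / 2)) ↔ _ := fun x =>
    mem_box_update_right hB
  have hupp : ∀ x, x ∈ box (Function.update A j ((A j + B j) / 2)) B ↔ _ := fun x =>
    mem_box_update_left hA
  refine ⟨fun x hx => ?_, fun x hx => ?_, fun p hp hpf => ?_⟩
  · split_ifs with h
    exacts [h₁.exp_neg_mul_le x ((hlow x).2 ⟨hx, h⟩),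
      h₂.exp_neg_mul_le x ((hupp x).2 ⟨hx, not_lt.1 h⟩)]
  · split_ifs with h
    exacts [h₁.le_exp_mul x ((hlow x).2 ⟨hx, h⟩), h₂.le_exp_mul x ((hupp x).2 ⟨hx, not_lt.1 h⟩)]
  · classical
    obtain ⟨hq, hqr⟩ := klInf_split hr (hAB j)
      (setAverage_box_pos hf hfi (lt_update_midpoint hAB j))
      (setAverage_box_pos hf hfi (update_midpoint_lt hAB j))
      (setAverage_box_eq_midpoint hfi hAB j) hp hpf
    obtain ⟨hq₁, hqr₁⟩ := h₁.klInf_piecewise _ hq fun x hx => by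
      obtain ⟨hx, hxj⟩ := (hlow x).1 hx
      rw [Set.piecewise_eq_of_mem _ _ _ hx, if_pos hxj]
    obtain ⟨hq₂, hqr₂⟩ := h₂.klInf_piecewise _ hq₁ fun x hx => by
      obtain ⟨hx, hxj⟩ := (hupp x).1 hx
      rw [Set.piecewise_eq_of_notMem _ _ _ fun h => hxj.not_gt ((hlow x).1 h).2,
        Set.piecewise_eq_of_mem _ _ _ hx, if_neg hxj.not_gt]
    suffices heq : (box A B).piecewise (fun x => if x j < (A j + B j) / 2 then s₁ x else s₂ x) p = _
      from heq ▸ ⟨hq₂, hqr₂.trans (hqr₁.trans hqr)⟩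
    ext x
    simp only [Set.piecewise, hlow, hupp]
    grind

lemma exists_isStepApprox_of_count {A₀ B₀ : Fin d → ℝ} {δ : ℝ} (hr : IsTarget r)
    (hf : ∀ x, 0 < f x) (hfi : Integrable f)
    (hosc : ∀ x ∈ box A₀ B₀, ∀ y ∈ box A₀ B₀, (∀ i, |x i - y i| < δ) → f y ≤ Real.exp η * f x)
    (l : Multiset (Fin d)) : ∀ {A B : Fin d → ℝ}, (∀ i, A i < B i) → box A B ⊆ box A₀ B₀ →
      (∀ i, B i - A i < 2 ^ l.count i * δ) → ∃ s, IsStepApprox r η f A B s := by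
  induction l using Multiset.induction with
  | empty =>
    intro A B hAB hsub hw
    refine ⟨_, isStepApprox_setAverage hfi hAB fun x hx y hy =>
      hosc x (hsub hx) y (hsub hy) fun i => ?_⟩
    have hwi := hw i
    rw [Multiset.count_zero, pow_zero, one_mul] at hwi
    exact abs_lt.2 ⟨by linarith [(hx i).1, (hy i).2], by linarith [(hx i).2, (hy i).1]⟩
  | cons j l ih =>
    intro A B hAB hsub hw
    have hA : A j ≤ (A j + B j) / 2 := by linarith [hAB j]
    have hB : (A j + B j) / 2 ≤ B j := by linarith [hAB j]
    have hwj := hw j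
    rw [Multiset.count_cons_self, pow_succ] at hwj
    have hwi : ∀ i ≠ j, B i - A i < 2 ^ l.count i * δ := fun i hi => by
      simpa only [Multiset.count_cons_of_ne hi] using hw i
    obtain ⟨s₁, hs₁⟩ := ih (lt_update_midpoint hAB j)
      (fun x hx => hsub ((mem_box_update_right hB).1 hx).1)
      ((Function.forall_update_iff B fun i b => b - A i < 2 ^ l.count i * δ).2
        ⟨by linarith, hwi⟩)
    obtain ⟨s₂, hs₂⟩ := ih (update_midpoint_lt hAB j)
      (fun x hx => hsub ((mem_box_update_left hA).1 hx).1)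
      ((Function.forall_update_iff A fun i a => B i - a < 2 ^ l.count i * δ).2
        ⟨by linarith, hwi⟩)
    exact ⟨_, hs₁.bisect hr hf hfi hAB j hs₂⟩

lemma exists_oscillation_bound (hfc : Continuous f) (hf : ∀ x, 0 < f x) (A B : Fin d → ℝ)
    (hη : 0 < η) :
    ∃ δ > 0, ∀ x ∈ box A B, ∀ y ∈ box A B, (∀ i, |x i - y i| < δ) → f y ≤ Real.exp η * f x := by
  have hc : Continuous fun v : Fin d → ℝ => Real.log (f (WithLp.toLp 2 v)) :=
    (hfc.comp (PiLp.continuous_toLp 2 _)).log fun v => (hf _).ne'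
  obtain ⟨δ, hδ, h⟩ := Metric.uniformContinuousOn_iff.1
    ((isCompact_Icc (a := A) (b := B)).uniformContinuousOn_of_continuous hc.continuousOn) η hη
  refine ⟨δ, hδ, fun x hx y hy hxy => ?_⟩
  have hlog : |Real.log (f x) - Real.log (f y)| < η :=
    h (WithLp.ofLp x) ⟨fun i => (hx i).1, fun i => (hx i).2.le⟩ (WithLp.ofLp y)
      ⟨fun i => (hy i).1, fun i => (hy i).2.le⟩ ((dist_pi_lt_iff hδ).2 hxy)
  rw [← Real.log_le_log_iff (hf y) (mul_pos (Real.exp_pos η) (hf x)),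
    Real.log_mul (Real.exp_pos η).ne' (hf x).ne', Real.log_exp]
  linarith [(abs_lt.1 hlog).1]

lemma exists_isStepApprox (hr : IsTarget r) (hfc : Continuous f) (hf : ∀ x, 0 < f x)
    (hfi : Integrable f) (hAB : ∀ i, A i < B i) (hη : 0 < η) : ∃ s, IsStepApprox r η f A B s := by
  obtain ⟨δ, hδ, hosc⟩ := exists_oscillation_bound hfc hf A B hη
  have hpow : Tendsto (fun k : ℕ => 2 ^ k * δ) atTop atTop :=
    (tendsto_pow_atTop_atTop_of_one_lt one_lt_two).atTop_mul_const hδ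
  obtain ⟨k, hk⟩ := (eventually_all.2 fun i => hpow.eventually_gt_atTop (B i - A i)).exists
  refine exists_isStepApprox_of_count hr hf hfi hosc (k • Finset.univ.val) hAB subset_rfl
    fun i => ?_
  rw [Multiset.count_nsmul, Multiset.count_univ, mul_one]
  exact hk i

/-! ### Redistributing the mass on a box -/

open Classical in
lemma IsDensity.piecewise {X : Type*} [MeasurableSpace X] {μ : Measure X} {p q : X → ℝ} {s : Set X}
    (hs : MeasurableSet s) (hp : IsDensity μ p) (hq : IsDensity μ q) :
    IsDensity μ (s.piecewise p q) where
  measurable := hp.measurable.piecewise hs hq.measurable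
  nonneg x := by
    by_cases hx : x ∈ s
    · simpa only [Set.piecewise_eq_of_mem _ _ _ hx] using hp.nonneg x
    · simpa only [Set.piecewise_eq_of_notMem _ _ _ hx] using hq.nonneg x
  integrable := Integrable.piecewise hs hp.integrable.integrableOn hq.integrable.integrableOn

open Classical in
lemma HasGaussianBound.piecewise {s : Set 𝔼} (hs : MeasurableSet s) (hp : HasGaussianBound C c p)
    (hq : HasGaussianBound C c q) : HasGaussianBound C c (s.piecewise p q) where
  measurable := hp.measurable.piecewise hs hq.measurable
  nonneg x := by
    by_cases hx : x ∈ s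
    · simpa only [Set.piecewise_eq_of_mem _ _ _ hx] using hp.nonneg x
    · simpa only [Set.piecewise_eq_of_notMem _ _ _ hx] using hq.nonneg x
  le x := by
    by_cases hx : x ∈ s
    · simpa only [Set.piecewise_eq_of_mem _ _ _ hx] using hp.le x
    · simpa only [Set.piecewise_eq_of_notMem _ _ _ hx] using hq.le x

lemma HasGaussianDecay.isDensity (hp : HasGaussianDecay p) : IsDensity volume p :=
  let ⟨_, _, hc, h⟩ := hp
  h.isDensity hc

open Classical in
lemma HasGaussianDecay.piecewise_const {s : Set 𝔼} {v : ℝ} (hs : MeasurableSet s)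
    (hsb : Bornology.IsBounded s) (hv : 0 ≤ v) (hp : HasGaussianDecay p) :
    HasGaussianDecay (s.piecewise (fun _ => v) p) := by
  obtain ⟨C, c, hc, hp⟩ := hp
  obtain ⟨R, hR⟩ := hsb.exists_norm_le
  refine ⟨max (v * Real.exp (c * R ^ 2)) C, c, hc, measurable_const.piecewise hs hp.measurable,
    fun x => ?_, fun x => ?_⟩
  all_goals by_cases hx : x ∈ s
  · simpa only [Set.piecewise_eq_of_mem _ _ _ hx] using hv
  · simpa only [Set.piecewise_eq_of_notMem _ _ _ hx] using hp.nonneg x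
  · rw [Set.piecewise_eq_of_mem _ _ _ hx]
    calc v = v * Real.exp (c * R ^ 2) * Real.exp (-(c * R ^ 2)) := by
          rw [mul_assoc, ← Real.exp_add, add_neg_cancel, Real.exp_zero, mul_one]
      _ ≤ max (v * Real.exp (c * R ^ 2)) C * Real.exp (-(c * ‖x‖ ^ 2)) := by
          gcongr
          exacts [le_max_left _ _, hR x hx]
  · rw [Set.piecewise_eq_of_notMem _ _ _ hx]
    exact (hp.le x).trans (by gcongr; exact le_max_right _ _)

lemma le_of_forall_exp_mul_add {a b : ENNReal} {K L : ℝ}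
    (h : ∀ η > 0, a ≤ ENNReal.ofReal (Real.exp η) * b +
      ENNReal.ofReal (Real.exp η * η * (Real.exp η * K) + (1 - Real.exp (-η)) * L)) : a ≤ b := by
  rcases eq_or_ne b ⊤ with rfl | hb
  · exact le_top
  have hmul : Tendsto (fun η : ℝ => ENNReal.ofReal (Real.exp η) * b) (𝓝[>] 0) (𝓝 b) := by
    have hexp : Continuous fun η : ℝ => ENNReal.ofReal (Real.exp η) :=
      ENNReal.continuous_ofReal.comp Real.continuous_exp
    simpa using ENNReal.Tendsto.mul_const ((hexp.tendsto 0).mono_left nhdsWithin_le_nhds)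
      (Or.inr hb)
  have herr : Tendsto (fun η : ℝ => ENNReal.ofReal (Real.exp η * η * (Real.exp η * K) +
      (1 - Real.exp (-η)) * L)) (𝓝[>] 0) (𝓝 0) := by
    have hcont : Continuous fun η : ℝ => ENNReal.ofReal (Real.exp η * η * (Real.exp η * K) +
      (1 - Real.exp (-η)) * L) := ENNReal.continuous_ofReal.comp (by fun_prop)
    simpa using (hcont.tendsto 0).mono_left nhdsWithin_le_nhds
  have hlim := hmul.add herr
  rw [add_zero] at hlim
  exact ge_of_tendsto hlim (eventually_mem_nhdsWithin.mono h)

lemma klInf_eq_of_forall_ratio {k : ENNReal} (hr : IsTarget r) (hq : IsDensity volume q)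
    (h : ∀ η > 0, ∃ p, IsDensity volume p ∧ (∀ x, Real.exp (-η) * q x ≤ p x) ∧
      (∀ x, p x ≤ Real.exp η * q x) ∧ klInf r p = k) : klInf r q = k := by
  refine le_antisymm (le_of_forall_exp_mul_add (K := ∫ x, q x) (L := ∫ x, r x) fun η hη => ?_)
    (le_of_forall_exp_mul_add (K := ∫ x, q x) (L := ∫ x, r x) fun η hη => ?_)
  all_goals obtain ⟨p, hp, hqp, hpq, rfl⟩ := h η hη
  · have hint : ∫ x, p x ≤ Real.exp η * ∫ x, q x := by
      rw [← integral_const_mul]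
      exact integral_mono hp.integrable (hq.integrable.const_mul _) hpq
    refine (klInf_le_of_ratio hr hη.le hq hp (fun x => ?_) fun x => ?_).trans (by gcongr)
    · rw [Real.exp_neg, inv_mul_le_iff₀ (Real.exp_pos η)]
      exact hpq x
    · rw [← inv_mul_le_iff₀ (Real.exp_pos η), ← Real.exp_neg]
      exact hqp x
  · have hint : ∫ x, q x ≤ Real.exp η * ∫ x, q x :=
      le_mul_of_one_le_left (integral_nonneg hq.nonneg) (Real.one_le_exp hη.le)
    exact (klInf_le_of_ratio hr hη.le hp hq hqp hpq).trans (by gcongr)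

open Classical in
lemma klInf_piecewise_setAverage (hr : IsTarget r) (hfc : Continuous f) (hf : ∀ x, 0 < f x)
    (hfd : HasGaussianDecay f) (hp : HasGaussianDecay p) (hAB : ∀ i, A i < B i) :
    klInf r ((box A B).piecewise f p) =
      klInf r ((box A B).piecewise (fun _ => ⨍ x in box A B, f x) p) := by
  have hbox := measurableSet_box A B
  refine klInf_eq_of_forall_ratio hr (.piecewise hbox hfd.isDensity hp.isDensity) fun η hη => ?_
  obtain ⟨s, hs⟩ := exists_isStepApprox hr hfc hf hfd.isDensity.integrable hAB hη
  obtain ⟨hsd, hsr⟩ := hs.klInf_piecewise _ (hp.piecewise_const hbox (isBounded_box A B)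
    (setAverage_box_pos hf hfd.isDensity.integrable hAB).le) fun x hx =>
      Set.piecewise_eq_of_mem _ _ _ hx
  refine ⟨_, hsd.isDensity, fun x => ?_, fun x => ?_, hsr⟩
  all_goals by_cases hx : x ∈ box A B
  · simpa only [Set.piecewise_eq_of_mem _ _ _ hx] using hs.exp_neg_mul_le x hx
  · simpa only [Set.piecewise_eq_of_notMem _ _ _ hx] using
      mul_le_of_le_one_left (hp.isDensity.nonneg x) (Real.exp_le_one_iff.2 (neg_nonpos.2 hη.le))
  · simpa only [Set.piecewise_eq_of_mem _ _ _ hx] using hs.le_exp_mul x hx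
  · simpa only [Set.piecewise_eq_of_notMem _ _ _ hx] using
      le_mul_of_one_le_left (hp.isDensity.nonneg x) (Real.one_le_exp hη.le)

open Classical in
lemma klInf_piecewise_of_setIntegral_eq (hr : IsTarget r) (hfc : Continuous f) (hf : ∀ x, 0 < f x)
    (hfd : HasGaussianDecay f) (hgc : Continuous g) (hg : ∀ x, 0 < g x) (hgd : HasGaussianDecay g)
    (hAB : ∀ i, A i < B i) (hfg : ∫ x in box A B, f x = ∫ x in box A B, g x) :
    klInf r ((box A B).piecewise f g) = klInf r g := by
  rw [klInf_piecewise_setAverage hr hfc hf hfd hgd hAB, setAverage_eq, hfg, ← setAverage_eq,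
    ← klInf_piecewise_setAverage hr hgc hg hgd hgd hAB, Set.piecewise_same]

/-! ### Vanishing of the infimal relative entropy -/

/-- The cube `[-(n + 1), n + 1)^d`. -/
def cube (d n : ℕ) : Set (EuclideanSpace ℝ (Fin d)) :=
  box (fun _ => -(n + 1 : ℝ)) fun _ => (n + 1 : ℝ)

lemma eventually_mem_cube (x : 𝔼) : ∀ᶠ n in atTop, x ∈ cube d n := by
  filter_upwards [tendsto_natCast_atTop_atTop.eventually_ge_atTop ‖x‖] with n hn i
  have h := abs_le.1 ((PiLp.norm_apply_le x i).trans hn)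
  constructor <;> linarith

lemma cube_side_lt (d n : ℕ) : ∀ _ : Fin d, -(n + 1 : ℝ) < n + 1 := fun _ => by
  linarith [n.cast_nonneg (α := ℝ)]

lemma tendsto_setIntegral_cube {f : ℕ → 𝔼 → ℝ} (hc : 0 < c) (hf : ∀ n, HasGaussianBound C c (f n))
    (hfq : ∀ᵐ x, Tendsto (fun n => f n x) atTop (𝓝 (q x))) :
    Tendsto (fun n => ∫ x in cube d n, f n x) atTop (𝓝 (∫ x, q x)) := by
  have hcube : ∀ n, MeasurableSet (cube d n) := fun n => measurableSet_box _ _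
  simp only [← integral_indicator (hcube _)]
  refine tendsto_integral_of_dominated_convergence (fun x => C * Real.exp (-(c * ‖x‖ ^ 2)))
    (fun n => ((hf n).measurable.indicator (hcube n)).aestronglyMeasurable)
    ((integrable_exp_neg_mul_norm_sq hc).const_mul C) (fun n => ae_of_all _ fun x => ?_) ?_
  · refine (norm_indicator_le_norm_self _ _).trans ?_
    rw [Real.norm_of_nonneg ((hf n).nonneg x)]
    exact (hf n).le x
  · filter_upwards [hfq] with x hx
    exact hx.congr' ((eventually_mem_cube x).mono fun n hn => (Set.indicator_of_mem hn _).symm)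

lemma exists_continuous_tendsto_ae (hq : Integrable q) :
    ∃ f : ℕ → 𝔼 → ℝ, (∀ n, Continuous (f n)) ∧ ∀ᵐ x, Tendsto (fun n => f n x) atTop (𝓝 (q x)) := by
  choose f _ hfq hfc hfi using fun n : ℕ =>
    (memLp_one_iff_integrable.2 hq).exists_hasCompactSupport_eLpNorm_sub_le ENNReal.one_ne_top
      (ENNReal.inv_ne_zero.2 (ENNReal.natCast_ne_top n))
  have hlim : Tendsto (fun n => eLpNorm (f n - q) 1 volume) atTop (𝓝 0) := by
    refine tendsto_of_tendsto_of_tendsto_of_le_of_le tendsto_const_nhds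
      ENNReal.tendsto_inv_nat_nhds_zero (fun _ => zero_le) fun n => ?_
    rw [eLpNorm_sub_comm]
    exact hfq n
  obtain ⟨φ, -, hφ⟩ := (tendstoInMeasure_of_tendsto_eLpNorm one_ne_zero
    (fun n => (hfi n).aestronglyMeasurable) hq.aestronglyMeasurable hlim).exists_seq_tendsto_ae
  exact ⟨fun n => f (φ n), fun n => hfc _, hφ⟩

lemma HasGaussianBound.exists_continuous_pos_tendsto (hc : 0 < c) (hq : HasGaussianBound C c q) :
    ∃ h : ℕ → 𝔼 → ℝ, (∀ n, Continuous (h n)) ∧ (∀ n x, 0 < h n x) ∧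
      (∀ n, HasGaussianBound (C + 1) c (h n)) ∧
      ∀ᵐ x, Tendsto (fun n => h n x) atTop (𝓝 (q x)) := by
  obtain ⟨f, hfc, hfq⟩ := exists_continuous_tendsto_ae (hq.isDensity hc).integrable
  set H : 𝔼 → ℝ := fun x => Real.exp (-(c * ‖x‖ ^ 2)) with hH
  have hHc : Continuous H := by
    rw [hH]
    fun_prop
  have hH0 : ∀ x, 0 < H x := fun x => Real.exp_pos _
  have hcont : ∀ n : ℕ, Continuous fun x => min |f n x| (C * H x) + 1 / ((n : ℝ) + 1) * H x :=
    fun n => ((hfc n).abs.min (hHc.const_mul C)).add (hHc.const_mul _)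
  have hpos : ∀ (n : ℕ) x, 0 < min |f n x| (C * H x) + 1 / ((n : ℝ) + 1) * H x := fun n x =>
    add_pos_of_nonneg_of_pos (le_min (abs_nonneg _) (mul_nonneg hq.const_nonneg (hH0 x).le))
      (mul_pos Nat.one_div_pos_of_nat (hH0 x))
  refine ⟨_, hcont, hpos, fun n => ⟨(hcont n).measurable, fun x => (hpos n x).le, fun x => ?_⟩, ?_⟩
  · rw [add_mul, one_mul]
    exact add_le_add (min_le_right _ _) (mul_le_of_le_one_left (hH0 x).le
      ((div_le_one (by positivity)).2 (by linarith [n.cast_nonneg (α := ℝ)])))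
  · filter_upwards [hfq] with x hx
    have hlim := (hx.abs.min (tendsto_const_nhds (x := C * H x))).add
      ((tendsto_one_div_add_atTop_nhds_zero_nat (𝕜 := ℝ)).mul_const (H x))
    rwa [abs_of_nonneg (hq.nonneg x), min_eq_left (hq.le x), zero_mul, add_zero] at hlim

lemma HasGaussianBound.exists_continuous_pos_setIntegral_cube_eq (hg : ∀ x, 0 < g x)
    (hgd : HasGaussianDecay g) (hc : 0 < c) (hq : HasGaussianBound C c q)
    (hqg : ∫ x, q x = ∫ x, g x) :
    ∃ (h : ℕ → 𝔼 → ℝ) (N : ℕ), (∀ n, Continuous (h n)) ∧ (∀ n x, 0 < h n x) ∧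
      (∀ n, HasGaussianBound (2 * (C + 1)) c (h n)) ∧
      (∀ n, ∫ x in cube d (n + N), h n x = ∫ x in cube d (n + N), g x) ∧
      ∀ᵐ x, Tendsto (fun n => h n x) atTop (𝓝 (q x)) := by
  obtain ⟨C', c', hc', hgC⟩ := id hgd
  obtain ⟨h, hhc, hh0, hhC, hhq⟩ := hq.exists_continuous_pos_tendsto hc
  have hgi := hgd.isDensity.integrable
  have hq0 : ∫ x, q x ≠ 0 := hqg ▸ (integral_pos_of_forall_pos (NeZero.ne _) hg hgi).ne'
  have hh_int : ∀ n, 0 < ∫ x in cube d n, h n x := fun n =>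
    setIntegral_box_pos (hh0 n) ((hhC n).isDensity hc).integrable (cube_side_lt d n)
  set κ : ℕ → ℝ := fun n => (∫ x in cube d n, g x) / ∫ x in cube d n, h n x
  have hκ0 : ∀ n, 0 < κ n := fun n =>
    div_pos (setIntegral_box_pos hg hgi (cube_side_lt d n)) (hh_int n)
  have hκ : Tendsto κ atTop (𝓝 1) := by
    have hlim := (tendsto_setIntegral_cube hc' (fun _ => hgC)
      (ae_of_all _ fun _ => tendsto_const_nhds)).div (tendsto_setIntegral_cube hc hhC hhq) hq0
    rwa [← hqg, div_self hq0] at hlim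
  obtain ⟨N, hN⟩ := eventually_atTop.1 (hκ.eventually_le_const one_lt_two)
  refine ⟨fun n x => κ (n + N) * h (n + N) x, N, fun n => (hhc _).const_mul _,
    fun n x => mul_pos (hκ0 _) (hh0 _ x),
    fun n => ((hhC (n + N)).const_mul (hκ0 _).le).mono
      (mul_le_mul_of_nonneg_right (hN _ (Nat.le_add_left _ _)) (hhC 0).const_nonneg) le_rfl,
    fun n => ?_, ?_⟩
  · rw [integral_const_mul]
    exact div_mul_cancel₀ _ (hh_int _).ne'
  · filter_upwards [hhq] with x hx
    have hlim := hκ.mul hx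
    rw [one_mul] at hlim
    exact hlim.comp (tendsto_add_atTop_nat N)

lemma klInf_le_of_integral_eq (hr : IsTarget r) (hgc : Continuous g) (hg : ∀ x, 0 < g x)
    (hgd : HasGaussianDecay g) (hc : 0 < c) (hq : HasGaussianBound C c q)
    (hqg : ∫ x, q x = ∫ x, g x) : klInf r g ≤ klInf r q := by
  classical
  obtain ⟨C', c', hc', hgC⟩ := id hgd
  obtain ⟨h, N, hhc, hh0, hhC, hhg, hhq⟩ :=
    hq.exists_continuous_pos_setIntegral_cube_eq hg hgd hc hqg
  refine le_klInf_of_tendsto hr (C := max (2 * (C + 1)) C') (c := min c c') (lt_min hc hc')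
    (p := fun n => (cube d (n + N)).piecewise (h n) g)
    (fun n => .piecewise (measurableSet_box _ _) ((hhC n).mono (le_max_left _ _) (min_le_left _ _))
      (hgC.mono (le_max_right _ _) (min_le_right _ _)))
    (hq.mono (le_max_of_le_left ?_) (min_le_left _ _)) ?_ fun n => ?_
  · linarith [hq.const_nonneg]
  · filter_upwards [hhq] with x hx
    exact hx.congr' (((tendsto_add_atTop_nat N).eventually (eventually_mem_cube x)).mono
      fun n hn => (Set.piecewise_eq_of_mem _ (h n) g hn).symm)
  · exact (klInf_piecewise_of_setIntegral_eq hr (hhc n) (hh0 n) ⟨_, c, hc, hhC n⟩ hgc hg hgd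
      (cube_side_lt d _) (hhg n)).ge

lemma tendsto_integral_min_exp (hr : IsTarget r) :
    Tendsto (fun n : ℕ => ∫ x, min (r x) (((n : ℝ) + 1) * Real.exp (-(1 * ‖x‖ ^ 2)))) atTop
      (𝓝 (∫ x, r x)) := by
  refine tendsto_integral_of_dominated_convergence r (fun n => ?_) hr.integrable
    (fun n => ae_of_all _ fun x => ?_) (ae_of_all _ fun x => ?_)
  · exact (hr.measurable.min (by fun_prop)).aestronglyMeasurable
  · rw [Real.norm_of_nonneg (le_min (hr.nonneg x) (by positivity))]
    exact min_le_left _ _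
  · have htop : Tendsto (fun n : ℕ => ((n : ℝ) + 1) * Real.exp (-(1 * ‖x‖ ^ 2))) atTop atTop :=
      (tendsto_atTop_add_const_right _ _ tendsto_natCast_atTop_atTop).atTop_mul_const
        (Real.exp_pos _)
    exact tendsto_const_nhds.congr'
      ((htop.eventually_ge_atTop (r x)).mono fun n hn => (min_eq_left hn).symm)

lemma klInf_eq_zero (hr : IsTarget r) (hr1 : ∫ x, r x = 1) (hgc : Continuous g)
    (hg : ∀ x, 0 < g x) (hgd : HasGaussianDecay g) (hg1 : ∫ x, g x = 1) : klInf r g = 0 := by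
  set h : ℕ → 𝔼 → ℝ := fun n x => min (r x) (((n : ℝ) + 1) * Real.exp (-(1 * ‖x‖ ^ 2)))
  have hh0 : ∀ n x, 0 < h n x := fun n x => lt_min (hr.pos x) (by positivity)
  have hhC : ∀ n : ℕ, HasGaussianBound ((n : ℝ) + 1) 1 (h n) := fun n =>
    ⟨hr.measurable.min (by fun_prop), fun x => (hh0 n x).le, fun x => min_le_right _ _⟩
  have hlim : Tendsto (fun n => ENNReal.ofReal (Real.log (∫ x, h n x)⁻¹)) atTop (𝓝 0) := by
    have hZ : Tendsto (fun n => ∫ x, h n x) atTop (𝓝 1) := hr1 ▸ tendsto_integral_min_exp hr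
    simpa using ENNReal.tendsto_ofReal ((hZ.inv₀ one_ne_zero).log (inv_ne_zero one_ne_zero))
  refine nonpos_iff_eq_zero.1 (ge_of_tendsto' hlim fun n => ?_)
  have hZ0 : 0 < ∫ x, h n x :=
    integral_pos_of_forall_pos (NeZero.ne _) (hh0 n) ((hhC n).isDensity one_pos).integrable
  have hqC := (hhC n).const_mul (inv_pos.2 hZ0).le
  have hq1 : ∫ x, (∫ x, h n x)⁻¹ * h n x = 1 := by
    rw [integral_const_mul, inv_mul_cancel₀ hZ0.ne']
  calc klInf r g
      ≤ klInf r fun x => (∫ x, h n x)⁻¹ * h n x :=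
        klInf_le_of_integral_eq hr hgc hg hgd one_pos hqC (hq1.trans hg1.symm)
    _ ≤ klDiv (densityMeasure fun x => (∫ x, h n x)⁻¹ * h n x) (densityMeasure r) :=
        klInf_le_klDiv _ _
    _ ≤ ENNReal.ofReal ((∫ x, (∫ x, h n x)⁻¹ * h n x) * Real.log (∫ x, h n x)⁻¹ +
          ((∫ x, r x) - ∫ x, (∫ x, h n x)⁻¹ * h n x)) :=
        (hqC.isDensity one_pos).klDiv_le_of_le_mul hr.toIsDensity hr.pos fun x =>
          mul_le_mul_of_nonneg_left (min_le_left _ _) (inv_pos.2 hZ0).le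
    _ = ENNReal.ofReal (Real.log (∫ x, h n x)⁻¹) := by rw [hq1, hr1, one_mul, sub_self, add_zero]

/-! ### Gaussian initial data -/

lemma stdGaussian_eq_withDensity (V : Type*) [NormedAddCommGroup V] [InnerProductSpace ℝ V]
    [FiniteDimensional ℝ V] [MeasurableSpace V] [BorelSpace V] :
    stdGaussian V = volume.withDensity fun x : V => ENNReal.ofReal
      (((2 * Real.pi) ^ ((Module.finrank ℝ V : ℝ) / 2))⁻¹ * Real.exp (-(1 / 2 * ‖x‖ ^ 2))) := by
  set Z : ℝ := (2 * Real.pi) ^ ((Module.finrank ℝ V : ℝ) / 2) with hZ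
  have hZ0 : 0 < Z := by positivity
  have hfin := isFiniteMeasure_withDensity_ofReal
    ((integrable_exp_neg_mul_norm_sq (V := V) one_half_pos).const_mul Z⁻¹).2
  have hZc : ((Real.pi : ℂ) / (1 / 2)) ^ ((Module.finrank ℝ V : ℂ) / 2) = Z := by
    rw [hZ, Complex.ofReal_cpow (by positivity)]
    push_cast
    congr 1
    ring
  refine Measure.ext_of_charFun (funext fun t => ?_)
  have hintegrand : ∀ x : V, (ENNReal.ofReal (Z⁻¹ * Real.exp (-(1 / 2 * ‖x‖ ^ 2)))).toReal •
      Complex.exp ((inner ℝ x t : ℝ) * Complex.I) =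
        (Z : ℂ)⁻¹ * Complex.exp (-(1 / 2) * ‖x‖ ^ 2 + Complex.I * (inner ℝ t x : ℝ)) := fun x => by
    rw [ENNReal.toReal_ofReal (by positivity), Complex.real_smul, Complex.exp_add, real_inner_comm,
      mul_comm Complex.I, ← mul_assoc]
    push_cast
    ring_nf
  rw [charFun_stdGaussian, charFun_apply, integral_withDensity_eq_integral_toReal_smul
      (by fun_prop) (ae_of_all _ fun _ => ENNReal.ofReal_lt_top), integral_congr_ae
      (ae_of_all _ hintegrand), integral_const_mul,
    GaussianFourier.integral_cexp_neg_mul_sq_norm_add (by norm_num), hZc,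
    inv_mul_cancel_left₀ (Complex.ofReal_ne_zero.2 hZ0.ne'), Complex.I_sq]
  congr 1
  ring

lemma hasJacobian_affine {V : Type*} [NormedAddCommGroup V] [NormedSpace ℝ V]
    [FiniteDimensional ℝ V] [MeasurableSpace V] [BorelSpace V] (μ : Measure V) [μ.IsAddHaarMeasure]
    (L : V ≃L[ℝ] V) (a : V) :
    HasJacobian μ (L.toHomeomorph.trans (Homeomorph.addLeft a))
      fun _ => |(LinearMap.det (L.toLinearEquiv : V →ₗ[ℝ] V))⁻¹| where
  measurable := measurable_const
  nonneg _ := abs_nonneg _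
  bounded := ⟨_, fun _ => le_rfl⟩
  map_eq := by
    have hdet := (LinearEquiv.isUnit_det' L.toLinearEquiv).ne_zero
    have hL : Measurable (L.toLinearEquiv : V →ₗ[ℝ] V) := L.continuous.measurable
    change μ.map ((fun x => a + x) ∘ ⇑(L.toLinearEquiv : V →ₗ[ℝ] V)) = _
    rw [← Measure.map_map (measurable_const_add a) hL,
      Measure.map_linearMap_addHaar_eq_smul_addHaar μ hdet, Measure.map_smul,
      map_add_left_eq_self, withDensity_const]

lemma exists_density_map_affine_stdGaussian (L : 𝔼 ≃L[ℝ] 𝔼) (a : 𝔼) :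
    ∃ g : 𝔼 → ℝ, Continuous g ∧ (∀ x, 0 < g x) ∧ HasGaussianDecay g ∧
      (stdGaussian 𝔼).map (fun x => a + L x) = densityMeasure g := by
  set Z : ℝ := (2 * Real.pi) ^ ((Module.finrank ℝ 𝔼 : ℝ) / 2)
  have hZ : 0 < Z⁻¹ := inv_pos.2 (by positivity)
  have hstd : HasGaussianBound Z⁻¹ (1 / 2) fun x : 𝔼 => Z⁻¹ * Real.exp (-(1 / 2 * ‖x‖ ^ 2)) :=
    ⟨by fun_prop, fun x => (mul_pos hZ (Real.exp_pos _)).le, fun x => le_rfl⟩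
  have hF := hasJacobian_affine volume L a
  have hdet := abs_pos.2 (inv_ne_zero (LinearEquiv.isUnit_det' L.toLinearEquiv).ne_zero)
  set F := L.toHomeomorph.trans (Homeomorph.addLeft a)
  have hF_le : ∀ x, ‖F x‖ ≤ (‖(L : 𝔼 →L[ℝ] 𝔼)‖ + 1) * ‖x‖ + ‖a‖ := fun x =>
    calc ‖a + L x‖ ≤ ‖a‖ + ‖L x‖ := norm_add_le _ _
      _ ≤ ‖a‖ + ‖(L : 𝔼 →L[ℝ] 𝔼)‖ * ‖x‖ := by
          gcongr
          exact (L : 𝔼 →L[ℝ] 𝔼).le_opNorm x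
      _ ≤ _ := by linarith [norm_nonneg x]
  refine ⟨_, ?_, fun x => ?_,
    ⟨_, _, ?_, hstd.push one_half_pos.le hF (fun _ => le_rfl) ?_ hF_le⟩, ?_⟩
  · have := F.symm.continuous
    unfold pushDensity
    fun_prop
  · exact mul_pos (mul_pos hZ (Real.exp_pos _)) hdet
  · positivity
  · positivity
  · rw [stdGaussian_eq_withDensity]
    exact hF.map_withDensity hstd.measurable

open scoped MatrixOrder in
lemma exists_density_multivariateGaussian (a : 𝔼) {S : Matrix (Fin d) (Fin d) ℝ} (hS : S.PosDef) :
    ∃ g : 𝔼 → ℝ, Continuous g ∧ (∀ x, 0 < g x) ∧ HasGaussianDecay g ∧ ∫ x, g x = 1 ∧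
      multivariateGaussian a S = densityMeasure g := by
  obtain ⟨U, hU⟩ := ((CFC.isUnit_sqrt_iff S hS.posSemidef.nonneg).2 hS.isUnit).map
    (Matrix.toEuclideanCLM (n := Fin d) (𝕜 := ℝ))
  obtain ⟨g, hgc, hg, hgd, hgS⟩ :=
    exists_density_map_affine_stdGaussian (ContinuousLinearEquiv.ofUnit U) a
  have hgS' : multivariateGaussian a S = densityMeasure g := by
    rw [← hgS, multivariateGaussian, ← hU]
    rfl
  refine ⟨g, hgc, hg, hgd, ?_, hgS'⟩
  rw [← ENNReal.ofReal_eq_one, ← hgd.isDensity.withDensity_ofReal_univ, ← densityMeasure, ← hgS']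
  exact measure_univ

/-! ### Targets with a Gaussian lower bound at infinity -/

lemma abs_log_le_of_isoGaussianDensity_le {σ t : ℝ} {x : 𝔼} (hσ : σ ≠ 0) (ht : 0 < t)
    (hxt : isoGaussianDensity σ x ≤ t) :
    |Real.log t| ≤ t + |Real.log ((2 * Real.pi * σ ^ 2) ^ ((d : ℝ) / 2))| +
      (2 * σ ^ 2)⁻¹ * ‖x‖ ^ 2 := by
  set Z := (2 * Real.pi * σ ^ 2) ^ ((d : ℝ) / 2) with hZ
  have hlower : -Real.log Z - (2 * σ ^ 2)⁻¹ * ‖x‖ ^ 2 ≤ Real.log t := by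
    have hlog := Real.log_le_log (by unfold isoGaussianDensity; positivity) hxt
    rw [isoGaussianDensity, ← hZ, Real.log_mul (by positivity) (Real.exp_ne_zero _), Real.log_exp,
      one_div, Real.log_inv, neg_div, div_eq_inv_mul] at hlog
    linarith
  have hupper := Real.log_le_sub_one_of_pos ht
  have hquad : 0 ≤ (2 * σ ^ 2)⁻¹ * ‖x‖ ^ 2 := by positivity
  exact abs_le.2 ⟨by linarith [le_abs_self (Real.log Z)], by linarith [abs_nonneg (Real.log Z)]⟩

lemma integrable_exp_neg_mul_abs_log (hri : Integrable r) (hr0 : ∀ᵐ x, 0 < r x)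
    (hlog : LocallyIntegrable fun x => Real.log (r x)) {M σ : ℝ} (hσ : σ ≠ 0)
    (htail : ∀ x, M ≤ ‖x‖ → isoGaussianDensity σ x ≤ r x) (hc : 0 < c) :
    Integrable fun x => Real.exp (-(c * ‖x‖ ^ 2)) * |Real.log (r x)| := by
  set K := |Real.log ((2 * Real.pi * σ ^ 2) ^ ((d : ℝ) / 2))|
  have hmeas : AEStronglyMeasurable fun x => Real.exp (-(c * ‖x‖ ^ 2)) * |Real.log (r x)| :=
    (by fun_prop : Continuous fun x : 𝔼 => Real.exp (-(c * ‖x‖ ^ 2))).aestronglyMeasurable.mul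
      hlog.aestronglyMeasurable.norm
  have hexp : ∀ x : 𝔼, Real.exp (-(c * ‖x‖ ^ 2)) ≤ 1 := fun x =>
    Real.exp_le_one_iff.2 (neg_nonpos.2 (by positivity))
  rw [← integrableOn_univ, ← Set.union_compl_self (Metric.closedBall (0 : 𝔼) M), integrableOn_union]
  constructor
  · refine (hlog.integrableOn_isCompact (isCompact_closedBall 0 M)).abs.mono' hmeas.restrict
      (ae_of_all _ fun x => ?_)
    rw [Real.norm_of_nonneg (by positivity)]
    exact mul_le_of_le_one_left (abs_nonneg _) (hexp x)
  · have hbound := (hri.add ((integrable_exp_neg_mul_norm_sq (V := 𝔼) hc).const_mul K)).add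
      ((integrable_norm_sq_mul_exp_neg_mul_norm_sq (V := 𝔼) hc).const_mul (2 * σ ^ 2)⁻¹)
    refine hbound.integrableOn.mono' hmeas.restrict ?_
    filter_upwards [ae_restrict_of_ae hr0,
      ae_restrict_mem Metric.isClosed_closedBall.measurableSet.compl] with x hx hxM
    have hMx : M ≤ ‖x‖ := by
      rw [Set.mem_compl_iff, mem_closedBall_zero_iff, not_le] at hxM
      exact hxM.le
    rw [Real.norm_of_nonneg (by positivity)]
    calc Real.exp (-(c * ‖x‖ ^ 2)) * |Real.log (r x)|
        ≤ Real.exp (-(c * ‖x‖ ^ 2)) * (r x + K + (2 * σ ^ 2)⁻¹ * ‖x‖ ^ 2) := by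
          gcongr
          exact abs_log_le_of_isoGaussianDensity_le hσ hx (htail x hMx)
      _ = Real.exp (-(c * ‖x‖ ^ 2)) * r x + K * Real.exp (-(c * ‖x‖ ^ 2)) +
            (2 * σ ^ 2)⁻¹ * (‖x‖ ^ 2 * Real.exp (-(c * ‖x‖ ^ 2))) := by ring
      _ ≤ r x + K * Real.exp (-(c * ‖x‖ ^ 2)) +
            (2 * σ ^ 2)⁻¹ * (‖x‖ ^ 2 * Real.exp (-(c * ‖x‖ ^ 2))) := by
          gcongr
          exact mul_le_of_le_one_left hx.le (hexp x)

lemma exists_isTarget_ae_eq (hpi : Integrable p) (hp0 : ∀ᵐ x, 0 < p x)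
    (hlog : ∀ c : ℝ, 0 < c → Integrable fun x => Real.exp (-(c * ‖x‖ ^ 2)) * |Real.log (p x)|) :
    ∃ r, IsTarget r ∧ r =ᵐ[volume] p := by
  have hpm := hpi.aestronglyMeasurable
  set f := hpm.mk p with hf_def
  have hf : Measurable f := hpm.stronglyMeasurable_mk.measurable
  have hfp : (fun x => if 0 < f x then f x else 1) =ᵐ[volume] p := by
    filter_upwards [hpm.ae_eq_mk, hp0] with x hpf hx
    rw [hf_def, ← hpf, if_pos hx]
  have hpos : ∀ x, 0 < if 0 < f x then f x else 1 := fun x => by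
    split_ifs with h
    exacts [h, one_pos]
  refine ⟨_, ⟨⟨hf.ite (measurableSet_lt measurable_const hf) measurable_const, fun x => (hpos x).le,
    hpi.congr hfp.symm⟩, hpos, fun c hc => (hlog c hc).congr ?_⟩, hfp⟩
  filter_upwards [hfp] with x hx
  rw [hx]

/-! ### Steering to an arbitrary target -/

lemma densityMeasure_congr (hpq : p =ᵐ[volume] q) : densityMeasure p = densityMeasure q :=
  withDensity_congr_ae (hpq.mono fun _ hx => congrArg ENNReal.ofReal hx)

lemma ae_eq_toReal_rnDeriv_densityMeasure (hp : IsDensity volume p) :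
    p =ᵐ[volume] fun x => ((densityMeasure p).rnDeriv volume x).toReal := by
  filter_upwards [Measure.rnDeriv_withDensity volume hp.measurable.ennreal_ofReal] with x hx
  rw [densityMeasure, hx, ENNReal.toReal_ofReal (hp.nonneg x)]

lemma IsContinuitySolution.congr_initial {T : ℝ} {θ : ℝ → Param d} {ρ : ℝ → 𝔼 → ℝ}
    (h : IsContinuitySolution T θ p ρ) (hpq : p =ᵐ[volume] q) : IsContinuitySolution T θ q ρ where
  integrable := h.integrable
  bounded := h.bounded
  continuous := h.continuous
  initial := h.initial.trans hpq
  weak φ hφ hc t ht := by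
    rw [h.weak φ hφ hc t ht, integral_congr_ae (hpq.mono fun x hx => congrArg (φ x * ·) hx)]

lemma Steers.integral_eq {T : ℝ} {F : 𝔼 → 𝔼} {θ : ℝ → Param d} {Φ : ℝ → 𝔼 → 𝔼} {ρ : ℝ → 𝔼 → ℝ}
    (hT : 0 ≤ T) (h : Steers T F p θ Φ ρ) (hF : Measurable F) : ∫ x, ρ T x = ∫ x, p x := by
  have hp : IsDensity volume p :=
    (h.density_zero ▸ h.isBoundedDensity 0 (Set.left_mem_Icc.2 hT)).toIsDensity
  have hρ : IsDensity volume (ρ T) := (h.isBoundedDensity T (Set.right_mem_Icc.2 hT)).toIsDensity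
  rw [← ENNReal.ofReal_eq_ofReal_iff (integral_nonneg hρ.nonneg) (integral_nonneg hp.nonneg),
    ← hρ.withDensity_ofReal_univ, ← hp.withDensity_ofReal_univ, ← densityMeasure, ← densityMeasure,
    ← h.map_eq, Measure.map_apply hF MeasurableSet.univ, Set.preimage_univ]

lemma exists_steers_klDiv_lt (hr : IsTarget r) (hr1 : ∫ x, r x = 1) (hgc : Continuous g)
    (hg : ∀ x, 0 < g x) (hc : 0 < c) (hgC : HasGaussianBound C c g) (hg1 : ∫ x, g x = 1)
    {T : ℝ} (hT : 0 < T) {ε : ENNReal} (hε : 0 < ε) :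
    ∃ (F : 𝔼 ≃ₜ 𝔼) (θ : ℝ → Param d) (Φ : ℝ → 𝔼 → 𝔼) (ρ : ℝ → 𝔼 → ℝ), Steers T F g θ Φ ρ ∧
      klDiv (densityMeasure (ρ T)) (densityMeasure r) < ε := by
  have hkl : klInf r g < ε := (klInf_eq_zero hr hr1 hgc hg ⟨C, c, hc, hgC⟩ hg1).trans_lt hε
  simp only [klInf, iInf_lt_iff] at hkl
  obtain ⟨F, hF, hlt⟩ := hkl
  obtain ⟨θ, Φ, ρ, h⟩ := steerable_of_mem hF T hT g (hgC.isBoundedDensity hc)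
  exact ⟨F, θ, Φ, ρ, h, h.map_eq ▸ hlt⟩

end NeuralTransport

theorem theorem2_general {d : ℕ} {g : EuclideanSpace ℝ (Fin d) → ℝ} {C c : ℝ}
    (hgc : Continuous g) (hg : ∀ x, 0 < g x) (hc : 0 < c)
    (hgC : ∀ x, g x ≤ C * Real.exp (-(c * ‖x‖ ^ 2))) (hg1 : ∫ x, g x = 1)
    {μB : Measure (EuclideanSpace ℝ (Fin d))} (hμB : μB = densityMeasure g)
    {ρs : EuclideanSpace ℝ (Fin d) → ℝ} (hρs : IsProbDensity ρs) (hpos : ∀ᵐ x, 0 < ρs x)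
    (hlog : ∀ a : ℝ, 0 < a → Integrable fun x => Real.exp (-(a * ‖x‖ ^ 2)) * |Real.log (ρs x)|)
    {T : ℝ} (hT : 0 < T) {ε : ℝ} (hε : 0 < ε) :
    ∃ (θ : ℝ → Param d) (Φ : ℝ → EuclideanSpace ℝ (Fin d) → EuclideanSpace ℝ (Fin d))
      (ρ : ℝ → EuclideanSpace ℝ (Fin d) → ℝ),
      IsPiecewiseConstant T θ ∧ IsFlow T θ Φ ∧
      IsContinuitySolution T θ (fun x => (μB.rnDeriv volume x).toReal) ρ ∧
      IsProbDensity (ρ T) ∧ μB.map (Φ T) = densityMeasure (ρ T) ∧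
      Integrable (fun x => ρ T x * Real.log (ρ T x / ρs x)) ∧
      ∫ x, ρ T x * Real.log (ρ T x / ρs x) ≤ ε ∧
      InformationTheory.klDiv (μB.map (Φ T)) (densityMeasure ρs) ≤ ENNReal.ofReal ε := by
  subst hμB
  obtain ⟨r, hr, hrρs⟩ := exists_isTarget_ae_eq hρs.integrable hpos hlog
  have hr1 : ∫ x, r x = 1 := (integral_congr_ae hrρs).trans hρs.integral_eq_one
  have hgC' : HasGaussianBound C c g := ⟨hgc.measurable, fun x => (hg x).le, hgC⟩
  obtain ⟨F, θ, Φ, ρ, h, hkl⟩ :=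
    exists_steers_klDiv_lt hr hr1 hgc hg hc hgC' hg1 hT (ENNReal.ofReal_pos.2 hε)
  have hρ : IsDensity volume (ρ T) := (h.isBoundedDensity T (Set.right_mem_Icc.2 hT.le)).toIsDensity
  have hρ1 : ∫ x, ρ T x = 1 := (h.integral_eq hT.le F.measurable).trans hg1
  have hmap : (densityMeasure g).map (Φ T) = densityMeasure (ρ T) := h.flow_end ▸ h.map_eq
  have hlog_eq : (fun x => ρ T x * Real.log (ρ T x / r x)) =ᵐ[volume]
      fun x => ρ T x * Real.log (ρ T x / ρs x) :=
    hrρs.mono fun x hx => congrArg (fun s => ρ T x * Real.log (ρ T x / s)) hx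
  refine ⟨θ, Φ, ρ, h.isPiecewiseConstant, h.isFlow hT.le, h.isContinuitySolution.congr_initial
      (ae_eq_toReal_rnDeriv_densityMeasure (hgC'.isDensity hc)),
    ⟨hρ.nonneg, hρ.integrable, hρ1⟩, hmap,
    (hρ.integrable_mul_log_div hr.toIsDensity hr.pos hkl.ne_top).congr hlog_eq, ?_, ?_⟩
  · rw [← integral_congr_ae hlog_eq,
      hρ.integral_mul_log_div hr.toIsDensity hr.pos (hρ1.trans hr1.symm)]
    exact ENNReal.toReal_le_of_le_ofReal hε.le hkl.le
  · rw [hmap, ← densityMeasure_congr hrρs]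
    exact hkl.le

theorem theorem2 {d : ℕ} (mB : EuclideanSpace ℝ (Fin d)) (SB : Matrix (Fin d) (Fin d) ℝ)
    (hSB : SB.PosDef) (μB : Measure (EuclideanSpace ℝ (Fin d)))
    (hμB : μB = ProbabilityTheory.multivariateGaussian mB SB)
    (ρs : EuclideanSpace ℝ (Fin d) → ℝ) (hρs : IsProbDensity ρs)
    (hent : Integrable (fun x => ρs x * Real.log (ρs x)))
    (hpos : ∀ᵐ x, 0 < ρs x) (hlog : LocallyIntegrable (fun x => Real.log (ρs x)))
    (M : ℝ) (hM : 0 < M) (σ : ℝ) (hσ : 0 < σ)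
    (htail : ∀ x, M ≤ ‖x‖ → isoGaussianDensity σ x ≤ ρs x)
    (T : ℝ) (hT : 0 < T) (ε : ℝ) (hε : 0 < ε) :
    ∃ (θ : ℝ → Param d) (Φ : ℝ → EuclideanSpace ℝ (Fin d) → EuclideanSpace ℝ (Fin d))
      (ρ : ℝ → EuclideanSpace ℝ (Fin d) → ℝ),
      IsPiecewiseConstant T θ ∧ IsFlow T θ Φ ∧
      IsContinuitySolution T θ (fun x => (μB.rnDeriv volume x).toReal) ρ ∧
      IsProbDensity (ρ T) ∧ μB.map (Φ T) = densityMeasure (ρ T) ∧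
      Integrable (fun x => ρ T x * Real.log (ρ T x / ρs x)) ∧
      ∫ x, ρ T x * Real.log (ρ T x / ρs x) ≤ ε ∧
      InformationTheory.klDiv (μB.map (Φ T)) (densityMeasure ρs) ≤ ENNReal.ofReal ε := by
  obtain ⟨g, hgc, hg, ⟨C, c, hc, hgC⟩, hg1, hμg⟩ := exists_density_multivariateGaussian mB hSB
  exact theorem2_general hgc hg hc hgC.le hg1 (hμB.trans hμg) hρs hpos
    (fun _ => integrable_exp_neg_mul_abs_log hρs.integrable hpos hlog hσ.ne' htail) hT hε
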